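/- Let $n\ge 1$. Let $K\subset\mathbb R^n$ denote an origin-symmetric convex body (compact, convex, with non-empty interior, $-K=K$), with volume $|K|$ and Minkowski functional $\|x\|_K=\inf\{\lambda\ge 0: x\in\lambda K\}$. For $1\le p<\infty$ put $$\|z\|_{Z_p^*K}^p=\frac{n+p}{2}\int_K|z\cdot y|^p\,dy\quad(z\in\mathbb R^n),$$ and, for $g$ on $\mathbb R^n\times\mathbb R^n$, $$[g]_{M^p}^p=\sup_{\lambda>0}\lambda^p\,\mathcal L^{2n}\big(\{(x,y)\in\mathbb R^n\times\mathbb R^n:\ |g(x,y)|\ge\lambda\}\big),$$ where $\mathcal L^{2n}$ is Lebesgue measure on $\mathbb R^n\times\mathbb R^n$. Functions $f$ are real-valued. (a) There is a constant $C=C(n)>0$, depending only on $n$, such that for all $1\le p<\infty$, all origin-symmetric convex bodies $K\subset\mathbb R^n$ and all $f\in C_c^\infty(\mathbb R^n)$, $$\frac2n\int_{\mathbb R^n}\|\nabla f(x)\|_{Z_p^*K}^p\,dx\ \le\ \left[\frac{f(x)-f(y)}{\|x-y\|_K^{\frac np+1}}\right]_{M^p}^p\ \le\ C\int_{\mathbb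 R^n}\|\nabla f(x)\|_{Z_p^*K}^p\,dx.$$ Moreover, with $E_{\lambda,K}=\Big\{(x,y)\in\mathbb R^n\times\mathbb R^n:\ x\ne y,\ \frac{|f(x)-f(y)|}{\|x-y\|_K^{n/p+1}}\ge\lambda\Big\}$, $$\lim_{\lambda\to\infty}\lambda^p\mathcal L^{2n}(E_{\lambda,K})=\frac2n\int_{\mathbb R^n}\|\nabla f(x)\|_{Z_p^*K}^p\,dx.$$ (b) For all $1\le p<\infty$, all origin-symmetric convex bodies $K\subset\mathbb R^n$ and all $f\in L^p(\mathbb R^n)$, $$2|K|\,\|f\|_{L^p(\mathbb R^n)}^p\ \le\ \left[\frac{f(x)-f(y)}{\|x-y\|_K^{\frac np}}\right]_{M^p}^p\ \le\ 2^{p+1}|K|\,\|f\|_{L^p(\mathbb R^n)}^p.$$ Moreover, with $\widetilde E_{\lambda,K}=\Big\{(x,y)\in\mathbb R^n\times\mathbb R^n:\ x\ne y,\ \frac{|f(x)-f(y)|}{\|x-y\|_K^{n/p}}\ge\lambda\Big\}$, $$\lim_{\lambda\to0^+}\lambda^p\mathcal L^{2n}(\widetilde E_{\lambda,K})=2|K|\,\|f\|_{L^p(\mathbb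 R^n)}^p.$$ -/

import Mathlib

open MeasureTheory Filter Topology
open scoped ENNReal NNReal ContDiff Gradient

noncomputable section

/-- Euclidean space `ℝⁿ`. -/
abbrev Rn (n : ℕ) : Type := EuclideanSpace ℝ (Fin n)

/-- `K ⊆ ℝⁿ` is an origin-symmetric convex body: compact, convex, with nonempty interior, and
`-K = K`. Its norm `‖·‖_K` is the Minkowski functional `gauge K`. -/
structure IsSymmConvexBody {n : ℕ} (K : Set (Rn n)) : Prop where
  isCompact : IsCompact K
  convex : Convex ℝ K
  nonempty_interior : (interior K).Nonempty
  neg_mem : ∀ x ∈ K, -x ∈ K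

/-- `‖z‖_{Z_p^* K} ^ p = (n + p) / 2 * ∫_K |z · y| ^ p dy`, the `p`-th power of the norm of the polar
`L^p` moment body of `K`. -/
def polarMomentNormPow {n : ℕ} (K : Set (Rn n)) (p : ℝ) (z : Rn n) : ℝ≥0∞ :=
  ENNReal.ofReal ((n + p) / 2) * ∫⁻ y in K, ENNReal.ofReal (|inner ℝ z y| ^ p)

/-- `∫ ‖∇f(x)‖_{Z_p^* K} ^ p dx`. -/
def anisotropicEnergy {n : ℕ} (K : Set (Rn n)) (p : ℝ) (f : Rn n → ℝ) : ℝ≥0∞ :=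
  ∫⁻ x, polarMomentNormPow K p (∇ f x)

/-- The `p`-th power `sup_{t > 0} t ^ p * 𝓛²ⁿ {|g| ≥ t}` of the Marcinkiewicz (weak `L^p`)
quasinorm of `g` on `ℝⁿ × ℝⁿ`. -/
def weakLpQuasinormPow {n : ℕ} (p : ℝ) (g : Rn n × Rn n → ℝ) : ℝ≥0∞ :=
  ⨆ (t : ℝ) (_ : 0 < t), ENNReal.ofReal (t ^ p) * volume {z : Rn n × Rn n | t ≤ |g z|}

/-- The function `(x, y) ↦ (f x - f y) / ‖x - y‖_K ^ s`. (On the diagonal, which is a null set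
when `n ≥ 1`, it is given the value `0`.) -/
def anisotropicQuotient {n : ℕ} (K : Set (Rn n)) (s : ℝ) (f : Rn n → ℝ) (z : Rn n × Rn n) : ℝ :=
  (f z.1 - f z.2) / gauge K (z.1 - z.2) ^ s

/-- The set `{(x, y) | x ≠ y, |f x - f y| / ‖x - y‖_K ^ s ≥ t}`. -/
def superlevelSet {n : ℕ} (K : Set (Rn n)) (s : ℝ) (f : Rn n → ℝ) (t : ℝ) : Set (Rn n × Rn n) :=
  {z | z.1 ≠ z.2 ∧ t ≤ |f z.1 - f z.2| / gauge K (z.1 - z.2) ^ s}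

end

/-!
Write `N` for the gauge of `K` and `v = y - x`, so that a pair `(x, y)` becomes a point `x` together
with an increment `v`. Polar coordinates are replaced by an average over `K`: since
`∫_{r ≥ N u} q * N u ^ q * r ^ (-1 - q) dr = 1`, Tonelli and the substitution `u = r • v` turn an
integral over the whole space into an integral over `v ∈ K` and `r > 0`.

In (a), the fundamental theorem of calculus and Hölder's inequality show that if `(x, r • v)` lies
in the set at level `t`, then the integral of `|∂_v f| ^ p` along the segment from `x` to
`x + r • v` is at least `t ^ p * N v ^ (n + p) * r ^ (n + 1)`. Vitali's covering lemma on each line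
parallel to `v` then bounds the measure of these pairs by the integral of `|∂_v f| ^ p`, with a
constant free of `p` and `K`. For the limit, rescale the increments by `τ = t ^ (-p / n)`: the
condition becomes `N v ^ (n / p + 1) ≤ |f (x + τ • v) - f x| / τ`. All these sets lie in one ball
and their indicators converge almost everywhere as `τ → 0`.

In (b), one of `|f x|`, `|f y|` has to be large. The pairs for which `f x` alone reaches the level
`t * N v ^ (n / p)` have measure exactly `t ^ (-p) * |K| * ‖f‖_p ^ p`, and so have those for which
`f y` does. Using the levels `t / 2` gives the upper bound. The pairs for which both do have
measure `o (t ^ (-p))` as `t → 0`, so the limit follows by comparing with the levels `(1 ± ε) * t`.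
-/

open scoped Pointwise

section StarBody

variable {E : Type*} [NormedAddCommGroup E] [NormedSpace ℝ E] {K : Set E}

/-- A star body: a compact set, star-shaped about the origin and absorbing every vector, so that
its gauge is a measurable positively homogeneous distance function, comparable from below with the
norm. Neither convexity nor symmetry is required. -/
structure IsStarBody (K : Set E) : Prop where
  isCompact : IsCompact K
  starConvex : StarConvex ℝ 0 K
  absorbent : Absorbent ℝ K

namespace IsStarBody

lemma gauge_le_one_iff (hK : IsStarBody K) {v : E} : gauge K v ≤ 1 ↔ v ∈ K := by
  refine ⟨fun hv => ?_, gauge_le_one_of_mem⟩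
  have hmem : ∀ᶠ r : ℝ in 𝓝[<] 1, r • v ∈ K := by
    filter_upwards [Ioo_mem_nhdsLT (zero_lt_one' ℝ)] with r hr
    have hlt : gauge K (r • v) < 1 := by
      rw [gauge_smul_of_nonneg hr.1.le, smul_eq_mul]
      exact (mul_le_of_le_one_right hr.1.le hv).trans_lt hr.2
    obtain ⟨b, hb0, hb1, y, hy, hyv⟩ := exists_lt_of_gauge_lt hK.absorbent hlt
    exact hyv ▸ hK.starConvex.smul_mem hy hb0.le hb1.le
  have hlim : Tendsto (fun r : ℝ => r • v) (𝓝[<] 1) (𝓝 v) := by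
    have hcont : Continuous fun r : ℝ => r • v := by fun_prop
    simpa using (hcont.tendsto 1).mono_left nhdsWithin_le_nhds
  exact hK.isCompact.isClosed.mem_of_tendsto hlim hmem

lemma gauge_pos (hK : IsStarBody K) {v : E} : 0 < gauge K v ↔ v ≠ 0 :=
  _root_.gauge_pos hK.absorbent (NormedSpace.isVonNBounded_of_isBounded ℝ hK.isCompact.isBounded)

lemma gauge_le_iff_mem_smul (hK : IsStarBody K) {a : ℝ} (ha : 0 < a) {v : E} :
    gauge K v ≤ a ↔ v ∈ a • K := by
  rw [Set.mem_smul_set_iff_inv_smul_mem₀ ha.ne', ← hK.gauge_le_one_iff,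
    gauge_smul_of_nonneg (inv_nonneg.2 ha.le), smul_eq_mul, inv_mul_le_one₀ ha]

lemma exists_norm_le_mul_gauge (hK : IsStarBody K) : ∃ R > 0, ∀ v, ‖v‖ ≤ R * gauge K v := by
  obtain ⟨R, hR, hKR⟩ := hK.isCompact.isBounded.exists_pos_norm_le
  refine ⟨R, hR, fun v => ?_⟩
  rcases eq_or_ne v 0 with rfl | hv
  · simp
  have hpos := hK.gauge_pos.2 hv
  obtain ⟨y, hy, hyv : gauge K v • y = v⟩ := (hK.gauge_le_iff_mem_smul hpos).1 le_rfl
  calc ‖v‖ = ‖gauge K v • y‖ := by rw [hyv]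
    _ = gauge K v * ‖y‖ := by rw [norm_smul, Real.norm_of_nonneg hpos.le]
    _ ≤ R * gauge K v := by
        rw [mul_comm]
        exact mul_le_mul_of_nonneg_right (hKR y hy) hpos.le

variable [MeasurableSpace E] [BorelSpace E]

lemma measurable_gauge (hK : IsStarBody K) : Measurable (gauge K) := by
  refine measurable_of_Iic fun a => ?_
  rcases lt_trichotomy a 0 with ha | rfl | ha
  · convert MeasurableSet.empty
    exact Set.eq_empty_of_forall_notMem fun v hv => (ha.trans_le (gauge_nonneg v)).not_ge hv
  · convert MeasurableSet.singleton (0 : E)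
    ext v
    simpa using (hK.gauge_pos (v := v)).not
  · convert (hK.isCompact.smul a).measurableSet
    ext v
    exact hK.gauge_le_iff_mem_smul ha

lemma measure_gauge_le [FiniteDimensional ℝ E] (hK : IsStarBody K) (μ : Measure E)
    [μ.IsAddHaarMeasure] {a : ℝ} (ha : 0 < a) :
    μ {v | gauge K v ≤ a} = ENNReal.ofReal (a ^ Module.finrank ℝ E) * μ K := by
  rw [← μ.addHaar_smul_of_nonneg ha.le]
  congr 1 with v
  exact hK.gauge_le_iff_mem_smul ha

end IsStarBody

end StarBody

section Radial

variable {E : Type*} [NormedAddCommGroup E] [NormedSpace ℝ E] [FiniteDimensional ℝ E]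
  [MeasurableSpace E] [BorelSpace E] {K : Set E} (μ : Measure E) [μ.IsAddHaarMeasure]

lemma setLIntegral_Ioc_rpow {a b : ℝ} (ha : -1 < a) (hb : 0 ≤ b) :
    ∫⁻ r in Set.Ioc 0 b, ENNReal.ofReal (r ^ a) = ENNReal.ofReal (b ^ (a + 1) / (a + 1)) := by
  rw [← ofReal_integral_eq_lintegral_ofReal
    (intervalIntegral.intervalIntegrable_rpow' ha).1, ← intervalIntegral.integral_of_le hb,
    integral_rpow (Or.inl ha), Real.zero_rpow (by linarith), sub_zero]
  filter_upwards [ae_restrict_mem measurableSet_Ioc] with y hy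
  exact Real.rpow_nonneg hy.1.le _

lemma setLIntegral_Ici_rpow {a b : ℝ} (ha : a < -1) (hb : 0 < b) :
    ∫⁻ r in Set.Ici b, ENNReal.ofReal (r ^ a) = ENNReal.ofReal (-b ^ (a + 1) / (a + 1)) := by
  rw [setLIntegral_congr Ioi_ae_eq_Ici.symm, ← integral_Ioi_rpow_of_lt ha hb,
    ofReal_integral_eq_lintegral_ofReal (integrableOn_Ioi_rpow_of_lt ha hb)]
  filter_upwards [ae_restrict_mem measurableSet_Ioi] with y hy
  exact Real.rpow_nonneg (hb.trans hy).le _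

lemma lintegral_eq_ofReal_pow_mul_lintegral_comp_smul {r : ℝ} (hr : 0 < r) {g : E → ℝ≥0∞}
    (hg : Measurable g) :
    ∫⁻ v, g v ∂μ = ENNReal.ofReal (r ^ Module.finrank ℝ E) * ∫⁻ v, g (r • v) ∂μ := by
  have hpow : 0 < r ^ Module.finrank ℝ E := by positivity
  rw [← lintegral_map hg (measurable_const_smul r), μ.map_addHaar_smul hr.ne',
    lintegral_smul_measure, smul_eq_mul, ← mul_assoc, abs_of_pos (inv_pos.2 hpow),
    ← ENNReal.ofReal_mul hpow.le, mul_inv_cancel₀ hpow.ne', ENNReal.ofReal_one, one_mul]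

lemma setLIntegral_Ici_mul_rpow_eq_one {q N : ℝ} (hq : 0 < q) (hN : 0 < N) :
    ∫⁻ r in Set.Ici N, ENNReal.ofReal (q * N ^ q * r ^ (-1 - q)) = 1 := by
  simp_rw [ENNReal.ofReal_mul (show 0 ≤ q * N ^ q by positivity)]
  rw [lintegral_const_mul _ (by fun_prop), setLIntegral_Ici_rpow (by linarith) hN,
    ← ENNReal.ofReal_mul (by positivity), ENNReal.ofReal_eq_one,
    show -1 - q + 1 = -q by ring, Real.rpow_neg hN.le]
  field_simp

namespace IsStarBody

lemma setLIntegral_gauge_le (hK : IsStarBody K) {q r : ℝ} (hr : 0 < r) {g : E → ℝ≥0∞}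
    (hg : Measurable g) :
    ∫⁻ u in {u | gauge K u ≤ r}, ENNReal.ofReal (q * gauge K u ^ q * r ^ (-1 - q)) * g u ∂μ =
      ∫⁻ v in K, ENNReal.ofReal (q * gauge K v ^ q) *
        (ENNReal.ofReal (r ^ (Module.finrank ℝ E - 1 : ℝ)) * g (r • v)) ∂μ := by
  have hN := hK.measurable_gauge
  have hset : MeasurableSet {u | gauge K u ≤ r} := measurableSet_le hN measurable_const
  rw [← lintegral_indicator hset, ← lintegral_indicator hK.isCompact.measurableSet,
    lintegral_eq_ofReal_pow_mul_lintegral_comp_smul μ hr (.indicator (by fun_prop) hset),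
    ← lintegral_const_mul' _ _ ENNReal.ofReal_ne_top]
  congr 1 with v
  have hrv : gauge K (r • v) = r * gauge K v := gauge_smul_of_nonneg hr.le v
  have hmem : r • v ∈ {u | gauge K u ≤ r} ↔ v ∈ K := by
    rw [Set.mem_ofPred_eq, hrv, mul_le_iff_le_one_right hr, hK.gauge_le_one_iff]
  by_cases hv : v ∈ K
  · have h0 := gauge_nonneg (s := K) v
    rw [Set.indicator_of_mem (hmem.2 hv), Set.indicator_of_mem hv, hrv, ← mul_assoc, ← mul_assoc,
      ← ENNReal.ofReal_mul (by positivity), ← ENNReal.ofReal_mul' (by positivity),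
      Real.mul_rpow hr.le h0, ← Real.rpow_natCast]
    congr 2
    rw [show (Module.finrank ℝ E - 1 : ℝ) = Module.finrank ℝ E + (q + (-1 - q)) by ring,
      Real.rpow_add hr, Real.rpow_add hr]
    ring
  · rw [Set.indicator_of_notMem (hmem.not.2 hv), Set.indicator_of_notMem hv, mul_zero]

/- The kernel `q * ‖u‖_K ^ q * r ^ (-1 - q)` on `{r ≥ ‖u‖_K}` has mass one in `r`; substituting
`u = r • v` and exchanging the order of integration turns it into an average over `K`. -/
lemma lintegral_eq_radial [Nontrivial E] (hK : IsStarBody K) {q : ℝ} (hq : 0 < q)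
    {g : E → ℝ≥0∞} (hg : Measurable g) :
    ∫⁻ v, g v ∂μ = ∫⁻ v in K, ENNReal.ofReal (q * gauge K v ^ q) *
      ∫⁻ r in Set.Ioi (0 : ℝ), ENNReal.ofReal (r ^ (Module.finrank ℝ E - 1 : ℝ)) * g (r • v)
        ∂volume ∂μ := by
  have hN := hK.measurable_gauge
  set A : Set (E × ℝ) := {z | gauge K z.1 ≤ z.2}
  have hA : MeasurableSet A := measurableSet_le (hN.comp measurable_fst) measurable_snd
  set H : E × ℝ → ℝ≥0∞ := A.indicator fun z =>
    ENNReal.ofReal (q * gauge K z.1 ^ q * z.2 ^ (-1 - q)) * g z.1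
  have hmass : ∀ u ≠ 0, ∫⁻ r in Set.Ioi (0 : ℝ), H (u, r) = g u := fun u hu => by
    have hu := hK.gauge_pos.2 hu
    rw [← one_mul (g u), ← setLIntegral_Ici_mul_rpow_eq_one hq hu,
      ← lintegral_mul_const _ (by fun_prop), ← lintegral_indicator measurableSet_Ioi,
      ← lintegral_indicator measurableSet_Ici]
    congr 1 with r
    by_cases hr : gauge K u ≤ r <;> simp [H, A, Set.indicator_apply, hr, hu.trans_le]
  have hscale : ∀ r ∈ Set.Ioi (0 : ℝ), ∫⁻ u, H (u, r) ∂μ = ∫⁻ v in K,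
      ENNReal.ofReal (q * gauge K v ^ q) *
        (ENNReal.ofReal (r ^ (Module.finrank ℝ E - 1 : ℝ)) * g (r • v)) ∂μ := fun r hr => by
    rw [← hK.setLIntegral_gauge_le μ hr hg,
      ← lintegral_indicator (measurableSet_le hN measurable_const)]
    rfl
  calc ∫⁻ v, g v ∂μ = ∫⁻ u, ∫⁻ r in Set.Ioi (0 : ℝ), H (u, r) ∂volume ∂μ := by
        refine lintegral_congr_ae ?_
        filter_upwards [compl_mem_ae_iff.2 (measure_singleton (μ := μ) (0 : E))] with u hu
        exact (hmass u hu).symm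
    _ = ∫⁻ r in Set.Ioi (0 : ℝ), ∫⁻ u, H (u, r) ∂μ :=
        lintegral_lintegral_swap (Measurable.indicator (by fun_prop) hA).aemeasurable
    _ = _ := by
        rw [setLIntegral_congr_fun measurableSet_Ioi hscale, lintegral_lintegral_swap (by fun_prop)]
        exact lintegral_congr fun v => lintegral_const_mul _ (by fun_prop)

end IsStarBody

end Radial

section Cone

variable {E : Type*} [NormedAddCommGroup E] [NormedSpace ℝ E] [FiniteDimensional ℝ E] [Nontrivial E]
  [MeasurableSpace E] [BorelSpace E] {K : Set E} (μ : Measure E) [μ.IsAddHaarMeasure]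

lemma mul_rpow_add_one_le_mul_iff {r N a σ : ℝ} (hr : 0 < r) (hN : 0 < N) (ha : 0 ≤ a)
    (hσ : 0 < σ) : (r * N) ^ (σ + 1) ≤ r * a ↔ r ≤ (a / N ^ (σ + 1)) ^ σ⁻¹ := by
  rw [Real.le_rpow_inv_iff_of_pos hr.le (by positivity) hσ, le_div_iff₀ (by positivity),
    Real.mul_rpow hr.le hN.le, Real.rpow_add_one hr.ne', mul_right_comm, mul_comm _ r,
    mul_le_mul_iff_right₀ hr]

lemma mul_rpow_add_one_eq_mul_iff {r N a σ : ℝ} (hr : 0 < r) (hN : 0 < N) (ha : 0 ≤ a)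
    (hσ : 0 < σ) : (r * N) ^ (σ + 1) = r * a ↔ r = (a / N ^ (σ + 1)) ^ σ⁻¹ := by
  rw [Real.eq_rpow_inv hr.le (by positivity) hσ.ne', eq_div_iff (by positivity),
    Real.mul_rpow hr.le hN.le, Real.rpow_add_one hr.ne', mul_right_comm, mul_comm _ r,
    mul_right_inj' hr.ne']

lemma setLIntegral_Ioi_rpow_mul_indicator {d p N a : ℝ} (hd : 0 < d) (hp : 0 < p) (hN : 0 < N)
    (ha : 0 ≤ a) :
    ∫⁻ r in Set.Ioi (0 : ℝ), ENNReal.ofReal (r ^ (d - 1)) *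
        {r : ℝ | (r * N) ^ (d / p + 1) ≤ r * a}.indicator 1 r =
      ENNReal.ofReal (a ^ p / (d * N ^ (d + p))) := by
  set ρ : ℝ := (a / N ^ (d / p + 1)) ^ (d / p)⁻¹
  have hρ : ρ ^ d = a ^ p / N ^ (d + p) := by
    rw [← Real.rpow_mul (by positivity), show (d / p)⁻¹ * d = p by field_simp,
      Real.div_rpow ha (by positivity), ← Real.rpow_mul hN.le]
    congr 2
    field_simp
  calc ∫⁻ r in Set.Ioi (0 : ℝ), ENNReal.ofReal (r ^ (d - 1)) *
        {r : ℝ | (r * N) ^ (d / p + 1) ≤ r * a}.indicator 1 r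
      = ∫⁻ r in Set.Ioc 0 ρ, ENNReal.ofReal (r ^ (d - 1)) := by
        rw [← lintegral_indicator measurableSet_Ioi, ← lintegral_indicator measurableSet_Ioc]
        congr 1 with r
        by_cases hr : 0 < r
        · simp [Set.indicator_apply, hr, ρ,
            mul_rpow_add_one_le_mul_iff hr hN ha (div_pos hd hp)]
        · simp [hr]
    _ = ENNReal.ofReal (a ^ p / (d * N ^ (d + p))) := by
        rw [setLIntegral_Ioc_rpow (by linarith) (by positivity), sub_add_cancel, hρ, div_div,
          mul_comm d]

namespace IsStarBody

lemma measure_gauge_rpow_eq_abs (hK : IsStarBody K) {σ : ℝ} (hσ : 0 < σ) (ℓ : E →L[ℝ] ℝ) :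
    μ {v | gauge K v ^ (σ + 1) = |ℓ v|} = 0 := by
  have hN := hK.measurable_gauge
  have hset : MeasurableSet {v | gauge K v ^ (σ + 1) = |ℓ v|} :=
    measurableSet_eq_fun (by fun_prop) (by fun_prop)
  rw [← lintegral_indicator_one hset,
    hK.lintegral_eq_radial μ one_pos (measurable_one.indicator hset)]
  refine lintegral_eq_zero_of_ae_eq_zero (.of_forall fun v => ?_)
  rcases eq_or_ne v 0 with rfl | hv
  · simp
  refine mul_eq_zero_of_right _ ((setLIntegral_congr_fun_ae measurableSet_Ioi ?_).trans
    lintegral_zero)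
  filter_upwards [Measure.ae_ne volume ((|ℓ v| / gauge K v ^ (σ + 1)) ^ σ⁻¹)] with r hr hr0
  have hr0 : 0 < r := hr0
  refine mul_eq_zero_of_right _ (Set.indicator_of_notMem (fun hmem => hr ?_) _)
  rwa [Set.mem_ofPred_eq, gauge_smul_of_nonneg hr0.le, smul_eq_mul, map_smul, smul_eq_mul, abs_mul,
    abs_of_pos hr0, mul_rpow_add_one_eq_mul_iff hr0 (hK.gauge_pos.2 hv) (abs_nonneg _) hσ] at hmem

lemma measure_gauge_rpow_le_abs (hK : IsStarBody K) {p : ℝ} (hp : 0 < p) (ℓ : E →L[ℝ] ℝ) :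
    μ {v | gauge K v ^ (Module.finrank ℝ E / p + 1) ≤ |ℓ v|} =
      ENNReal.ofReal ((Module.finrank ℝ E + p) / Module.finrank ℝ E) *
        ∫⁻ v in K, ‖ℓ v‖ₑ ^ p ∂μ := by
  have hd : (0 : ℝ) < Module.finrank ℝ E := Nat.cast_pos.2 Module.finrank_pos
  have hN := hK.measurable_gauge
  have hset : MeasurableSet {v | gauge K v ^ (Module.finrank ℝ E / p + 1) ≤ |ℓ v|} :=
    measurableSet_le (by fun_prop) (by fun_prop)
  rw [← lintegral_indicator_one hset, hK.lintegral_eq_radial μ (add_pos hd hp)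
    (measurable_one.indicator hset), ← lintegral_const_mul _ (by fun_prop)]
  refine lintegral_congr fun v => ?_
  rcases eq_or_ne v 0 with rfl | hv
  · simp [hp, (add_pos hd hp).ne']
  have hv := hK.gauge_pos.2 hv
  have hray : ∀ r : ℝ, 0 < r →
      {v | gauge K v ^ (Module.finrank ℝ E / p + 1) ≤ |ℓ v|}.indicator (1 : E → ℝ≥0∞) (r • v) =
        {r : ℝ | (r * gauge K v) ^ (Module.finrank ℝ E / p + 1) ≤ r * |ℓ v|}.indicator 1 r := by
    intro r hr
    simp only [Set.indicator_apply, Set.mem_ofPred_eq, gauge_smul_of_nonneg hr.le,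
      smul_eq_mul, map_smul, abs_mul, abs_of_pos hr, Pi.one_apply]
  rw [setLIntegral_congr_fun measurableSet_Ioi fun r hr => congrArg _ (hray r hr),
    setLIntegral_Ioi_rpow_mul_indicator hd hp hv (abs_nonneg _),
    ← ENNReal.ofReal_mul (by positivity), Real.enorm_eq_ofReal_abs,
    ENNReal.ofReal_rpow_of_nonneg (abs_nonneg _) hp.le, ← ENNReal.ofReal_mul (by positivity)]
  congr 1
  field_simp

end IsStarBody

end Cone

section Vitali

lemma exists_countable_disjoint_Icc_covering {A : Set (ℝ × ℝ)} {R : ℝ}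
    (hA : ∀ z ∈ A, z.2 ∈ Set.Ioc 0 R) :
    ∃ J ⊆ A, J.Countable ∧ J.PairwiseDisjoint (fun z => Set.Icc z.1 (z.1 + z.2)) ∧
      A ⊆ ⋃ z ∈ J, Set.Icc (z.1 - 2 * z.2) (z.1 + 3 * z.2) ×ˢ Set.Ioc 0 (5 * z.2) := by
  have hball : ∀ z : ℝ × ℝ, Metric.closedBall (z.1 + z.2 / 2) (z.2 / 2)
      = Set.Icc z.1 (z.1 + z.2) := fun z => by
    rw [Real.closedBall_eq_Icc]
    ring_nf
  obtain ⟨J, hJA, hJd, hJ⟩ := Vitali.exists_disjoint_subfamily_covering_enlargement_closedBall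
    A (fun z => z.1 + z.2 / 2) (fun z => z.2 / 2) (R / 2)
    (fun z hz => by linarith [(hA z hz).2]) 5 (by norm_num)
  simp only [hball] at hJd hJ
  refine ⟨J, hJA, hJd.countable_of_nonempty_interior fun z hz => ?_, hJd, fun z hz => ?_⟩
  · rw [interior_Icc]
    exact Set.nonempty_Ioo.2 (by linarith [(hA z (hJA hz)).1])
  · obtain ⟨j, hj, hsub⟩ := hJ z hz
    have hz0 := (hA z hz).1
    rw [Real.closedBall_eq_Icc, Set.Icc_subset_Icc_iff (by linarith)] at hsub
    refine Set.mem_iUnion₂.2 ⟨j, hj, ⟨?_, ?_⟩, hz0, ?_⟩ <;> linarith [hsub.1, hsub.2]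

lemma setLIntegral_Icc_prod_Ioc_rpow {a b c d : ℝ} (hd : 0 < d) (hc : 0 ≤ c) :
    ∫⁻ z in Set.Icc a b ×ˢ Set.Ioc 0 c, ENNReal.ofReal (z.2 ^ (d - 1)) =
      ENNReal.ofReal (b - a) * ENNReal.ofReal (c ^ d / d) := by
  rw [Measure.volume_eq_prod, setLIntegral_prod _ (by fun_prop)]
  simp only [setLIntegral_Ioc_rpow (show -1 < d - 1 by linarith) hc, sub_add_cancel,
    lintegral_const, Measure.restrict_apply_univ, Real.volume_Icc]
  rw [mul_comm]

lemma mul_setLIntegral_rpow_le_of_heavy_Icc {A : Set (ℝ × ℝ)} {R d : ℝ} (hd : 0 < d)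
    {c : ℝ≥0∞} {u : ℝ → ℝ≥0∞} (hA : ∀ z ∈ A, z.2 ∈ Set.Ioc 0 R)
    (hheavy : ∀ z ∈ A, c * ENNReal.ofReal (z.2 ^ (d + 1)) ≤ ∫⁻ s in Set.Icc z.1 (z.1 + z.2), u s) :
    c * ∫⁻ z in A, ENNReal.ofReal (z.2 ^ (d - 1)) ≤
      ENNReal.ofReal (5 ^ (d + 1) / d) * ∫⁻ s, u s := by
  obtain ⟨J, hJA, hJc, hJd, hJ⟩ := exists_countable_disjoint_Icc_covering hA
  have := hJc.to_subtype
  have hrect : ∀ z ∈ J, c * ∫⁻ y in Set.Icc (z.1 - 2 * z.2) (z.1 + 3 * z.2) ×ˢ Set.Ioc 0 (5 * z.2),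
      ENNReal.ofReal (y.2 ^ (d - 1)) ≤
        ENNReal.ofReal (5 ^ (d + 1) / d) * ∫⁻ s in Set.Icc z.1 (z.1 + z.2), u s := fun z hz => by
    have hz0 := (hA z (hJA hz)).1
    calc _ = ENNReal.ofReal (5 ^ (d + 1) / d) * (c * ENNReal.ofReal (z.2 ^ (d + 1))) := by
          rw [setLIntegral_Icc_prod_Ioc_rpow hd (by linarith), ← ENNReal.ofReal_mul (by linarith),
            mul_left_comm, ← ENNReal.ofReal_mul (by positivity)]
          congr 2
          rw [Real.mul_rpow (by norm_num) hz0.le, Real.rpow_add_one (by norm_num),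
            Real.rpow_add_one hz0.ne']
          ring
      _ ≤ _ := by gcongr; exact hheavy z (hJA hz)
  calc c * ∫⁻ z in A, ENNReal.ofReal (z.2 ^ (d - 1))
      ≤ c * ∑' z : J, ∫⁻ y in Set.Icc (z.1.1 - 2 * z.1.2) (z.1.1 + 3 * z.1.2) ×ˢ
          Set.Ioc 0 (5 * z.1.2), ENNReal.ofReal (y.2 ^ (d - 1)) := by
        gcongr
        refine (lintegral_mono_set hJ).trans ?_
        rw [Set.biUnion_eq_iUnion]
        exact lintegral_iUnion_le _ _
    _ ≤ ∑' z : J, ENNReal.ofReal (5 ^ (d + 1) / d) *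
          ∫⁻ s in Set.Icc z.1.1 (z.1.1 + z.1.2), u s := by
        rw [← ENNReal.tsum_mul_left]
        exact ENNReal.tsum_le_tsum fun z => hrect z z.2
    _ = ENNReal.ofReal (5 ^ (d + 1) / d) * ∫⁻ s in ⋃ z ∈ J, Set.Icc z.1 (z.1 + z.2), u s := by
        rw [ENNReal.tsum_mul_left, lintegral_biUnion hJc (fun _ _ => measurableSet_Icc) hJd]
    _ ≤ _ := by
        gcongr
        exact Measure.restrict_le_self

lemma setLIntegral_Icc_self_add (u : ℝ → ℝ≥0∞) (t r : ℝ) :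
    ∫⁻ s in Set.Icc t (t + r), u s = ∫⁻ s in Set.Icc 0 r, u (t + s) := by
  rw [← (measurePreserving_add_left volume t).setLIntegral_comp_preimage_emb
    (measurableEmbedding_addLeft t)]
  simp

variable {E : Type*} [NormedAddCommGroup E] [NormedSpace ℝ E] [MeasurableSpace E] [BorelSpace E]

lemma mul_setLIntegral_le_of_heavy_on_line {A : Set (E × ℝ)} (hAm : MeasurableSet A) {R d : ℝ}
    (hd : 0 < d) {c : ℝ≥0∞} {F : E → ℝ≥0∞} {w : E} (hA : ∀ z ∈ A, z.2 ∈ Set.Ioc 0 R)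
    (hheavy : ∀ z ∈ A, c * ENNReal.ofReal (z.2 ^ (d + 1)) ≤
      ∫⁻ s in Set.Icc 0 z.2, F (z.1 + s • w)) (x : E) :
    c * ∫⁻ t in Set.Icc 0 R, ∫⁻ r, A.indicator (fun z => ENNReal.ofReal (z.2 ^ (d - 1)))
        (x + t • w, r) ≤
      ENNReal.ofReal (5 ^ (d + 1) / d) * ∫⁻ s in Set.Icc 0 (2 * R), F (x + s • w) := by
  set S : Set (ℝ × ℝ) := {z | (x + z.1 • w, z.2) ∈ A}
  have hS : MeasurableSet S :=
    hAm.preimage (f := fun z : ℝ × ℝ => (x + z.1 • w, z.2)) (by fun_prop)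
  have hSheavy : ∀ z ∈ S ∩ Set.Icc 0 R ×ˢ Set.univ, c * ENNReal.ofReal (z.2 ^ (d + 1)) ≤
      ∫⁻ s in Set.Icc z.1 (z.1 + z.2),
        (Set.Icc 0 (2 * R)).indicator (fun s => F (x + s • w)) s := by
    rintro ⟨t, r⟩ ⟨hz, ht, -⟩
    have hr := hA _ hz
    have hsub : Set.Icc t (t + r) ⊆ Set.Icc 0 (2 * R) :=
      Set.Icc_subset_Icc ht.1 (by linarith [ht.2, hr.2])
    rw [setLIntegral_indicator measurableSet_Icc, Set.inter_eq_right.2 hsub,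
      setLIntegral_Icc_self_add]
    simpa only [add_smul, add_assoc] using hheavy _ hz
  have key := mul_setLIntegral_rpow_le_of_heavy_Icc hd (fun z hz => hA _ hz.1) hSheavy
  rw [lintegral_indicator measurableSet_Icc, ← Measure.restrict_restrict hS,
    Measure.volume_eq_prod, ← Measure.prod_restrict, Measure.restrict_univ,
    ← lintegral_indicator hS, lintegral_prod _ (Measurable.indicator (by fun_prop) hS).aemeasurable]
    at key
  exact key

variable [FiniteDimensional ℝ E] {μ : Measure E} [μ.IsAddHaarMeasure]

lemma lintegral_setLIntegral_add_smul {H : E → ℝ≥0∞} (hH : Measurable H) (w : E) (T : Set ℝ) :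
    ∫⁻ x, ∫⁻ t in T, H (x + t • w) ∂volume ∂μ = volume T * ∫⁻ x, H x ∂μ := by
  rw [lintegral_lintegral_swap (by fun_prop)]
  simp_rw [lintegral_add_right_eq_self H]
  rw [setLIntegral_const, mul_comm]

lemma mul_setLIntegral_rpow_le_of_heavy_segment_of_le {A : Set (E × ℝ)} (hAm : MeasurableSet A)
    {R d : ℝ} (hR : 0 < R) (hd : 0 < d) {c : ℝ≥0∞} {F : E → ℝ≥0∞} (hF : Measurable F) {w : E}
    (hA : ∀ z ∈ A, z.2 ∈ Set.Ioc 0 R)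
    (hheavy : ∀ z ∈ A, c * ENNReal.ofReal (z.2 ^ (d + 1)) ≤
      ∫⁻ s in Set.Icc 0 z.2, F (z.1 + s • w)) :
    c * ∫⁻ z in A, ENNReal.ofReal (z.2 ^ (d - 1)) ∂μ.prod volume ≤
      2 * ENNReal.ofReal (5 ^ (d + 1) / d) * ∫⁻ x, F x ∂μ := by
  set G : E → ℝ≥0∞ := fun x => ∫⁻ r, A.indicator (fun z => ENNReal.ofReal (z.2 ^ (d - 1))) (x, r)
  have hind : Measurable (A.indicator fun z => ENNReal.ofReal (z.2 ^ (d - 1))) :=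
    .indicator (by fun_prop) hAm
  have hG : Measurable G := hind.lintegral_prod_right'
  have hscaled : ENNReal.ofReal R * (c * ∫⁻ x, G x ∂μ) ≤
      ENNReal.ofReal R * (2 * ENNReal.ofReal (5 ^ (d + 1) / d) * ∫⁻ x, F x ∂μ) := by
    calc ENNReal.ofReal R * (c * ∫⁻ x, G x ∂μ)
        = ∫⁻ x, c * ∫⁻ t in Set.Icc 0 R, G (x + t • w) ∂volume ∂μ := by
          rw [lintegral_const_mul _ (by fun_prop), lintegral_setLIntegral_add_smul hG,
            Real.volume_Icc, sub_zero, mul_left_comm]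
      _ ≤ ∫⁻ x, ENNReal.ofReal (5 ^ (d + 1) / d) *
            ∫⁻ s in Set.Icc 0 (2 * R), F (x + s • w) ∂volume ∂μ :=
          lintegral_mono (mul_setLIntegral_le_of_heavy_on_line hAm hd hA hheavy)
      _ = _ := by
          rw [lintegral_const_mul _ (by fun_prop), lintegral_setLIntegral_add_smul hF,
            Real.volume_Icc, sub_zero, ENNReal.ofReal_mul zero_le_two, ENNReal.ofReal_ofNat]
          ring
  rw [← lintegral_indicator hAm, lintegral_prod _ hind.aemeasurable]
  exact (ENNReal.mul_le_mul_iff_right (by simpa using hR) ENNReal.ofReal_ne_top).1 hscaled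

/- Neither constant depends on the bound `R` on the lengths, so it may be removed by exhaustion. -/
lemma mul_setLIntegral_rpow_le_of_heavy_segment {A : Set (E × ℝ)} (hAm : MeasurableSet A)
    {d : ℝ} (hd : 0 < d) {c : ℝ≥0∞} {F : E → ℝ≥0∞} (hF : Measurable F) {w : E}
    (hA : ∀ z ∈ A, 0 < z.2)
    (hheavy : ∀ z ∈ A, c * ENNReal.ofReal (z.2 ^ (d + 1)) ≤
      ∫⁻ s in Set.Icc 0 z.2, F (z.1 + s • w)) :
    c * ∫⁻ z in A, ENNReal.ofReal (z.2 ^ (d - 1)) ∂μ.prod volume ≤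
      2 * ENNReal.ofReal (5 ^ (d + 1) / d) * ∫⁻ x, F x ∂μ := by
  have hcut : A = ⋃ N : ℕ, A ∩ {z | z.2 ≤ N + 1} := by
    refine (Set.iUnion_subset fun _ => Set.inter_subset_left).antisymm' fun z hz => ?_
    obtain ⟨N, hN⟩ := exists_nat_ge z.2
    exact Set.mem_iUnion.2 ⟨N, hz, hN.trans (by simp)⟩
  have hmono : Monotone fun N : ℕ => A ∩ {z | z.2 ≤ N + 1} := fun M N hMN z hz =>
    ⟨hz.1, (show z.2 ≤ M + 1 from hz.2).trans (by gcongr)⟩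
  rw [hcut, setLIntegral_iUnion_of_directed _ hmono.directed_le, ENNReal.mul_iSup]
  refine iSup_le fun N => mul_setLIntegral_rpow_le_of_heavy_segment_of_le (R := N + 1)
    (hAm.inter (measurableSet_le measurable_snd measurable_const)) (by positivity) hd hF
    (fun z hz => ⟨hA z hz.1, hz.2⟩) fun z hz => hheavy z hz.1

end Vitali

section FundamentalTheorem

lemma enorm_integral_rpow_le {α F : Type*} [MeasurableSpace α] {ν : Measure α}
    [NormedAddCommGroup F] [NormedSpace ℝ F] {φ : α → F} (hφ : AEStronglyMeasurable φ ν)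
    {p : ℝ} (hp : 1 ≤ p) :
    ‖∫ a, φ a ∂ν‖ₑ ^ p ≤ ν Set.univ ^ (p - 1) * ∫⁻ a, ‖φ a‖ₑ ^ p ∂ν := by
  have hp0 : 0 < p := by linarith
  have hholder : ‖∫ a, φ a ∂ν‖ₑ ≤ eLpNorm' φ p ν * ν Set.univ ^ (1 / 1 - 1 / p) := by
    refine le_trans ?_ (eLpNorm'_le_eLpNorm'_mul_rpow_measure_univ one_pos hp hφ)
    simpa [eLpNorm'] using enorm_integral_le_lintegral_enorm φ
  calc ‖∫ a, φ a ∂ν‖ₑ ^ p ≤ (eLpNorm' φ p ν * ν Set.univ ^ (1 / 1 - 1 / p)) ^ p := by gcongr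
    _ = ν Set.univ ^ (p - 1) * ∫⁻ a, ‖φ a‖ₑ ^ p ∂ν := by
      rw [ENNReal.mul_rpow_of_nonneg _ _ hp0.le, ← ENNReal.rpow_mul, eLpNorm', ← ENNReal.rpow_mul,
        one_div_mul_cancel hp0.ne', ENNReal.rpow_one, mul_comm]
      congr 2
      field_simp

variable {E : Type*} [NormedAddCommGroup E] [NormedSpace ℝ E] {f : E → ℝ}

lemma hasDerivAt_comp_add_smul (hf : ContDiff ℝ 1 f) (x w : E) (s : ℝ) :
    HasDerivAt (fun s : ℝ => f (x + s • w)) (fderiv ℝ f (x + s • w) w) s := by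
  have hline : HasDerivAt (fun s : ℝ => x + s • w) w s := by
    simpa using ((hasDerivAt_id s).smul_const w).const_add x
  exact (hf.differentiable one_ne_zero _).hasFDerivAt.comp_hasDerivAt s hline

lemma enorm_sub_rpow_le_lintegral_fderiv (hf : ContDiff ℝ 1 f) {p : ℝ} (hp : 1 ≤ p) (x w : E)
    {r : ℝ} (hr : 0 < r) :
    ‖f (x + r • w) - f x‖ₑ ^ p ≤ ENNReal.ofReal (r ^ (p - 1)) *
      ∫⁻ s in Set.Icc 0 r, ‖fderiv ℝ f (x + s • w) w‖ₑ ^ p := by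
  have hcont : Continuous fun s : ℝ => fderiv ℝ f (x + s • w) w := by
    have := hf.continuous_fderiv one_ne_zero
    fun_prop
  have hftc : ∫ s in Set.Icc 0 r, fderiv ℝ f (x + s • w) w = f (x + r • w) - f x := by
    rw [integral_Icc_eq_integral_Ioc, ← intervalIntegral.integral_of_le hr.le,
      intervalIntegral.integral_eq_sub_of_hasDerivAt (fun s _ => hasDerivAt_comp_add_smul hf x w s)
        (hcont.intervalIntegrable _ _)]
    simp
  rw [← hftc, ← ENNReal.ofReal_rpow_of_pos hr]
  simpa using enorm_integral_rpow_le (ν := volume.restrict (Set.Icc 0 r))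
    hcont.aestronglyMeasurable hp

end FundamentalTheorem

section Increment

variable {E : Type*} [NormedAddCommGroup E] [NormedSpace ℝ E] {K : Set E} {f : E → ℝ}

/-- The superlevel set `{(x, y) | x ≠ y, |f x - f y| / ‖x - y‖_K ^ s ≥ t}`, in the coordinates
`(x, v)` with base point `x` and increment `v`. The inequality is multiplied out, so that no
division by zero occurs. -/
def incrementSet (K : Set E) (s : ℝ) (f : E → ℝ) (t : ℝ) : Set (E × E) :=
  {z | z.2 ≠ 0 ∧ t * gauge K z.2 ^ s ≤ |f (z.1 + z.2) - f z.1|}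

lemma heavy_segment_of_mem_incrementSet {d p t r : ℝ} {x v : E} (hd : 0 < d)
    (hp : 1 ≤ p) (ht : 0 < t) (hr : 0 < r) (hf : ContDiff ℝ 1 f)
    (hmem : (x, r • v) ∈ incrementSet K (d / p + 1) f t) :
    ENNReal.ofReal (t ^ p * gauge K v ^ (d + p)) * ENNReal.ofReal (r ^ (d + 1)) ≤
      ∫⁻ s in Set.Icc 0 r, ‖fderiv ℝ f (x + s • v) v‖ₑ ^ p := by
  have hp0 : 0 < p := by linarith
  have hN := gauge_nonneg (s := K) v
  have hrp : 0 < r ^ (p - 1) := by positivity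
  have hpow : r ^ (p - 1) * (t ^ p * gauge K v ^ (d + p) * r ^ (d + 1)) =
      (t * (r * gauge K v) ^ (d / p + 1)) ^ p := by
    rw [Real.mul_rpow ht.le (by positivity), ← Real.rpow_mul (by positivity),
      show (d / p + 1) * p = d + p by field_simp, Real.mul_rpow hr.le hN,
      show r ^ (d + p) = r ^ (p - 1) * r ^ (d + 1) by rw [← Real.rpow_add hr]; ring_nf]
    ring
  refine (ENNReal.mul_le_mul_iff_right (ENNReal.ofReal_pos.2 hrp).ne' ENNReal.ofReal_ne_top).1 ?_
  calc _ = ENNReal.ofReal (t * (r * gauge K v) ^ (d / p + 1)) ^ p := by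
        rw [← ENNReal.ofReal_mul (by positivity), ← ENNReal.ofReal_mul hrp.le, hpow,
          ENNReal.ofReal_rpow_of_nonneg (by positivity) hp0.le]
    _ ≤ ‖f (x + r • v) - f x‖ₑ ^ p := by
        rw [Real.enorm_eq_ofReal_abs, ← smul_eq_mul r, ← gauge_smul_of_nonneg hr.le]
        gcongr
        exact hmem.2
    _ ≤ _ := enorm_sub_rpow_le_lintegral_fderiv hf hp x v hr

variable [FiniteDimensional ℝ E] [MeasurableSpace E] [BorelSpace E]

lemma measurableSet_incrementSet (hK : IsStarBody K) (hf : Measurable f) (s t : ℝ) :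
    MeasurableSet (incrementSet K s f t) := by
  have hN := hK.measurable_gauge
  exact ((measurableSet_singleton 0).preimage measurable_snd).compl.inter
    (measurableSet_le (f := fun z : E × E => t * gauge K z.2 ^ s) (by fun_prop) (by fun_prop))

end Increment

section Upper

variable {E : Type*} [NormedAddCommGroup E] [NormedSpace ℝ E] [FiniteDimensional ℝ E]
  [MeasurableSpace E] [BorelSpace E] {K : Set E} {f : E → ℝ} (μ : Measure E) [μ.IsAddHaarMeasure]

lemma mul_lintegral_measure_incrementSet_le (hK : IsStarBody K) {d p t : ℝ} (hd : 0 < d)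
    (hp : 1 ≤ p) (ht : 0 < t) (hf : ContDiff ℝ 1 f) (v : E) :
    ENNReal.ofReal (t ^ p * gauge K v ^ (d + p)) * ∫⁻ r in Set.Ioi (0 : ℝ),
        ENNReal.ofReal (r ^ (d - 1)) * μ {x | (x, r • v) ∈ incrementSet K (d / p + 1) f t} ≤
      2 * ENNReal.ofReal (5 ^ (d + 1) / d) * ∫⁻ x, ‖fderiv ℝ f x v‖ₑ ^ p ∂μ := by
  set S := incrementSet K (d / p + 1) f t
  have hS : MeasurableSet S := measurableSet_incrementSet hK hf.continuous.measurable _ _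
  set B : Set (E × ℝ) := {z | (z.1, z.2 • v) ∈ S}
  have hB : MeasurableSet B := hS.preimage (f := fun z : E × ℝ => (z.1, z.2 • v)) (by fun_prop)
  have hF : Measurable fun x => ‖fderiv ℝ f x v‖ₑ ^ p := by
    have := hf.continuous_fderiv one_ne_zero
    fun_prop
  have key := mul_setLIntegral_rpow_le_of_heavy_segment (μ := μ)
    (hB.inter (measurableSet_Ioi.preimage measurable_snd)) hd hF (fun z hz => hz.2)
    fun z hz => heavy_segment_of_mem_incrementSet hd hp ht hz.2 hf hz.1
  rw [← Set.univ_prod, ← Measure.restrict_restrict hB, ← Measure.prod_restrict,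
    Measure.restrict_univ, ← lintegral_indicator hB,
    lintegral_prod_symm _ (Measurable.indicator (by fun_prop) hB).aemeasurable] at key
  refine le_trans (le_of_eq ?_) key
  refine congrArg _ (lintegral_congr fun r => ?_)
  have hfiber : MeasurableSet {x | (x, r • v) ∈ S} := hS.preimage (by fun_prop)
  rw [← setLIntegral_const, ← lintegral_indicator hfiber]
  rfl

theorem ofReal_rpow_mul_measure_incrementSet_le [Nontrivial E] (hK : IsStarBody K) {p t : ℝ}
    (hp : 1 ≤ p) (ht : 0 < t) (hf : ContDiff ℝ 1 f) :
    ENNReal.ofReal (t ^ p) *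
        μ.prod μ (incrementSet K (Module.finrank ℝ E / p + 1) f t) ≤
      2 * ENNReal.ofReal (5 ^ (Module.finrank ℝ E + 1 : ℝ) / Module.finrank ℝ E) *
        (ENNReal.ofReal (Module.finrank ℝ E + p) *
          ∫⁻ x, ∫⁻ v in K, ‖fderiv ℝ f x v‖ₑ ^ p ∂μ ∂μ) := by
  have hd : (0 : ℝ) < Module.finrank ℝ E := Nat.cast_pos.2 Module.finrank_pos
  set S := incrementSet K (Module.finrank ℝ E / p + 1) f t
  have hS : MeasurableSet S := measurableSet_incrementSet hK hf.continuous.measurable _ _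
  have := hK.measurable_gauge
  have := hf.continuous_fderiv one_ne_zero
  have hfiber : Measurable fun v => μ {x | (x, v) ∈ S} := measurable_measure_prodMk_right hS
  have hscale : ∀ v, ENNReal.ofReal (t ^ p) * ENNReal.ofReal
      ((Module.finrank ℝ E + p) * gauge K v ^ (Module.finrank ℝ E + p)) =
        ENNReal.ofReal (Module.finrank ℝ E + p) *
          ENNReal.ofReal (t ^ p * gauge K v ^ (Module.finrank ℝ E + p)) := fun v => by
    rw [← ENNReal.ofReal_mul (by positivity), ← ENNReal.ofReal_mul (by positivity), mul_left_comm]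
  calc ENNReal.ofReal (t ^ p) * μ.prod μ S
      = ENNReal.ofReal (t ^ p) * ∫⁻ v, μ {x | (x, v) ∈ S} ∂μ := by
        rw [Measure.prod_apply_symm hS]
        rfl
    _ = ENNReal.ofReal (Module.finrank ℝ E + p) * ∫⁻ v in K,
          ENNReal.ofReal (t ^ p * gauge K v ^ (Module.finrank ℝ E + p)) *
            ∫⁻ r in Set.Ioi (0 : ℝ), ENNReal.ofReal (r ^ (Module.finrank ℝ E - 1 : ℝ)) *
              μ {x | (x, r • v) ∈ S} ∂volume ∂μ := by
        rw [hK.lintegral_eq_radial μ (add_pos hd (zero_lt_one.trans_le hp)) hfiber,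
          ← lintegral_const_mul' _ _ ENNReal.ofReal_ne_top,
          ← lintegral_const_mul' _ _ ENNReal.ofReal_ne_top]
        simp only [← mul_assoc, hscale]
    _ ≤ ENNReal.ofReal (Module.finrank ℝ E + p) * ∫⁻ v in K,
          2 * ENNReal.ofReal (5 ^ (Module.finrank ℝ E + 1 : ℝ) / Module.finrank ℝ E) *
            ∫⁻ x, ‖fderiv ℝ f x v‖ₑ ^ p ∂μ ∂μ := by
        refine mul_le_mul_right (lintegral_mono fun v => ?_) _
        exact mul_lintegral_measure_incrementSet_le μ hK hd hp ht hf v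
    _ = _ := by
        rw [lintegral_const_mul' _ _ (by finiteness), lintegral_lintegral_swap (by fun_prop),
          mul_left_comm]

end Upper

section SmoothLimit

lemma mem_tsupport_or_of_sub_ne_zero {X : Type*} [TopologicalSpace X] {f : X → ℝ} {x y : X}
    (h : f y - f x ≠ 0) : x ∈ tsupport f ∨ y ∈ tsupport f := by
  by_contra! hxy
  simp [image_eq_zero_of_notMem_tsupport hxy.1, image_eq_zero_of_notMem_tsupport hxy.2] at h

variable {E : Type*} [NormedAddCommGroup E] [NormedSpace ℝ E] {K : Set E} {f : E → ℝ}

lemma smul_mem_incrementSet_iff {σ τ : ℝ} (hτ : 0 < τ) {x v : E} :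
    (x, τ • v) ∈ incrementSet K (σ + 1) f (τ ^ (-σ)) ↔
      v ≠ 0 ∧ gauge K v ^ (σ + 1) ≤ |τ⁻¹ * (f (x + τ • v) - f x)| := by
  have hcancel : τ ^ (-σ) * (τ * gauge K v) ^ (σ + 1) = τ * gauge K v ^ (σ + 1) := by
    rw [Real.mul_rpow hτ.le (gauge_nonneg _), ← mul_assoc, ← Real.rpow_add hτ,
      neg_add_cancel_left, Real.rpow_one]
  simp only [incrementSet, Set.mem_ofPred_eq, gauge_smul_of_nonneg hτ.le, smul_eq_mul, hcancel,
    abs_mul, abs_of_pos (inv_pos.2 hτ), le_inv_mul_iff₀ hτ, ne_eq, smul_eq_zero, hτ.ne', false_or]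

lemma tendsto_inv_mul_sub_fderiv (hf : ContDiff ℝ 1 f) (x v : E) :
    Tendsto (fun τ : ℝ => τ⁻¹ * (f (x + τ • v) - f x)) (𝓝[>] 0) (𝓝 (fderiv ℝ f x v)) := by
  simpa using (hasDerivAt_comp_add_smul hf x v 0).tendsto_slope_zero_right

lemma IsStarBody.exists_norm_le_of_lipschitz (hK : IsStarBody K) {L : ℝ≥0}
    (hL : LipschitzWith L f) {σ : ℝ} (hσ : 0 < σ) :
    ∃ R : ℝ, ∀ (x v : E) (τ : ℝ), 0 < τ → v ≠ 0 →
      gauge K v ^ (σ + 1) ≤ |τ⁻¹ * (f (x + τ • v) - f x)| → ‖v‖ ≤ R := by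
  obtain ⟨c, hc, hcN⟩ := hK.exists_norm_le_mul_gauge
  refine ⟨c * (L * c) ^ σ⁻¹, fun x v τ hτ hv h => ?_⟩
  have hN := hK.gauge_pos.2 hv
  have hquot : |τ⁻¹ * (f (x + τ • v) - f x)| ≤ L * c * gauge K v := by
    have hdist := hL.dist_le_mul (x + τ • v) x
    rw [Real.dist_eq, dist_eq_norm, add_sub_cancel_left, norm_smul, Real.norm_of_nonneg hτ.le]
      at hdist
    rw [abs_mul, abs_of_pos (inv_pos.2 hτ), inv_mul_le_iff₀ hτ]
    calc |f (x + τ • v) - f x| ≤ L * (τ * ‖v‖) := hdist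
      _ ≤ L * (τ * (c * gauge K v)) := by gcongr; exact hcN v
      _ = τ * (L * c * gauge K v) := by ring
  have hgauge : gauge K v ≤ (L * c) ^ σ⁻¹ := by
    rw [Real.le_rpow_inv_iff_of_pos hN.le (by positivity) hσ]
    rw [Real.rpow_add_one hN.ne'] at h
    exact le_of_mul_le_mul_right (h.trans hquot) hN
  exact (hcN v).trans (by gcongr)

lemma IsStarBody.exists_norm_le_of_smul_mem_incrementSet (hK : IsStarBody K)
    (hf : ContDiff ℝ 1 f) (hc : HasCompactSupport f) {σ : ℝ} (hσ : 0 < σ) :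
    ∃ R : ℝ, ∀ (x v : E) (τ : ℝ), 0 < τ → τ ≤ 1 →
      (x, τ • v) ∈ incrementSet K (σ + 1) f (τ ^ (-σ)) → ‖x‖ ≤ R ∧ ‖v‖ ≤ R := by
  obtain ⟨L, hL⟩ := hf.lipschitzWith_of_hasCompactSupport hc one_ne_zero
  obtain ⟨R, hR⟩ := hK.exists_norm_le_of_lipschitz hL hσ
  obtain ⟨R₀, hR₀, hsupp⟩ := hc.isCompact.isBounded.exists_pos_norm_le
  refine ⟨R₀ + R, fun x v τ hτ hτ1 hmem => ?_⟩
  obtain ⟨hv0, hquot⟩ := (smul_mem_incrementSet_iff hτ).1 hmem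
  have hv := hR x v τ hτ hv0 hquot
  have hsub : f (x + τ • v) - f x ≠ 0 := fun h => by
    have hN : 0 < gauge K v ^ (σ + 1) := Real.rpow_pos_of_pos (hK.gauge_pos.2 hv0) _
    rw [h, mul_zero, abs_zero] at hquot
    exact hN.not_ge hquot
  refine ⟨?_, by linarith⟩
  rcases mem_tsupport_or_of_sub_ne_zero hsub with hx | hx
  · linarith [hsupp x hx, norm_nonneg v]
  · calc ‖x‖ ≤ ‖x + τ • v‖ + ‖τ • v‖ := by simpa using norm_sub_le (x + τ • v) (τ • v)
      _ ≤ R₀ + ‖v‖ := by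
        rw [norm_smul, Real.norm_of_nonneg hτ.le]
        gcongr
        exacts [hsupp _ hx, mul_le_of_le_one_left (norm_nonneg _) hτ1]
      _ ≤ R₀ + R := by gcongr

variable [FiniteDimensional ℝ E] [MeasurableSpace E] [BorelSpace E] (μ : Measure E)
  [μ.IsAddHaarMeasure]

lemma measure_preimage_prodMk_smul {S : Set (E × E)} (hS : MeasurableSet S) {τ : ℝ} (hτ : 0 < τ) :
    μ.prod μ ((fun z : E × E => (z.1, τ • z.2)) ⁻¹' S) =
      ENNReal.ofReal (τ ^ Module.finrank ℝ E)⁻¹ * μ.prod μ S := by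
  rw [Measure.prod_apply (hS.preimage (by fun_prop)), Measure.prod_apply hS,
    ← lintegral_const_mul' _ _ ENNReal.ofReal_ne_top]
  refine lintegral_congr fun x => ?_
  rw [← abs_of_pos (inv_pos.2 (pow_pos hτ (Module.finrank ℝ E))),
    ← Measure.addHaar_preimage_smul _ hτ.ne']
  rfl

variable [Nontrivial E]

lemma measure_gauge_rpow_le_abs_fderiv (hK : IsStarBody K) (hf : ContDiff ℝ 1 f) {p : ℝ}
    (hp : 0 < p) :
    μ.prod μ {z | gauge K z.2 ^ (Module.finrank ℝ E / p + 1) ≤ |fderiv ℝ f z.1 z.2|} =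
      ENNReal.ofReal ((Module.finrank ℝ E + p) / Module.finrank ℝ E) *
        ∫⁻ x, ∫⁻ v in K, ‖fderiv ℝ f x v‖ₑ ^ p ∂μ ∂μ := by
  have hN := hK.measurable_gauge
  have := hf.continuous_fderiv one_ne_zero
  rw [Measure.prod_apply (measurableSet_le (by fun_prop) (by fun_prop)),
    ← lintegral_const_mul' _ _ ENNReal.ofReal_ne_top]
  exact lintegral_congr fun x => hK.measure_gauge_rpow_le_abs μ hp (fderiv ℝ f x)

lemma ae_gauge_rpow_ne_abs_fderiv (hK : IsStarBody K) (hf : ContDiff ℝ 1 f) {σ : ℝ} (hσ : 0 < σ) :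
    ∀ᵐ z ∂μ.prod μ, gauge K z.2 ^ (σ + 1) ≠ |fderiv ℝ f z.1 z.2| := by
  have hN := hK.measurable_gauge
  have := hf.continuous_fderiv one_ne_zero
  rw [ae_iff]
  simp only [not_not]
  exact Measure.measure_prod_null_of_ae_null (measurableSet_eq_fun (by fun_prop) (by fun_prop))
    (ae_of_all _ fun x => hK.measure_gauge_rpow_eq_abs μ hσ (fderiv ℝ f x))

lemma ae_eventually_smul_mem_incrementSet_iff (hK : IsStarBody K) (hf : ContDiff ℝ 1 f) {σ : ℝ}
    (hσ : 0 < σ) :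
    ∀ᵐ z ∂μ.prod μ, ∀ᶠ τ : ℝ in 𝓝[>] 0, (z.1, τ • z.2) ∈ incrementSet K (σ + 1) f (τ ^ (-σ)) ↔
      gauge K z.2 ^ (σ + 1) ≤ |fderiv ℝ f z.1 z.2| := by
  filter_upwards [ae_gauge_rpow_ne_abs_fderiv μ hK hf hσ] with ⟨x, v⟩ hz
  have hv : v ≠ 0 := by
    rintro rfl
    simp [gauge_zero, Real.zero_rpow (by positivity : σ + 1 ≠ 0)] at hz
  have hquot := (tendsto_inv_mul_sub_fderiv hf x v).abs
  rcases hz.lt_or_gt with h | h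
  · filter_upwards [hquot.eventually_const_lt h, self_mem_nhdsWithin] with τ hτ hτ0
    rw [smul_mem_incrementSet_iff hτ0]
    exact iff_of_true ⟨hv, hτ.le⟩ h.le
  · filter_upwards [hquot.eventually_lt_const h, self_mem_nhdsWithin] with τ hτ hτ0
    rw [smul_mem_incrementSet_iff hτ0]
    exact iff_of_false (fun hmem => hτ.not_ge hmem.2) h.not_ge

lemma tendsto_rpow_mul_measure_incrementSet_atTop (hK : IsStarBody K) (hf : ContDiff ℝ 1 f)
    (hc : HasCompactSupport f) {p : ℝ} (hp : 0 < p) :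
    Tendsto (fun t : ℝ => ENNReal.ofReal (t ^ p) *
        μ.prod μ (incrementSet K (Module.finrank ℝ E / p + 1) f t)) atTop
      (𝓝 (ENNReal.ofReal ((Module.finrank ℝ E + p) / Module.finrank ℝ E) *
        ∫⁻ x, ∫⁻ v in K, ‖fderiv ℝ f x v‖ₑ ^ p ∂μ ∂μ)) := by
  have hd : (0 : ℝ) < Module.finrank ℝ E := Nat.cast_pos.2 Module.finrank_pos
  have hσ : (0 : ℝ) < Module.finrank ℝ E / p := by positivity
  have hN := hK.measurable_gauge
  have := hf.continuous_fderiv one_ne_zero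
  have hS := measurableSet_incrementSet hK hf.continuous.measurable (Module.finrank ℝ E / p + 1)
  obtain ⟨R, hR⟩ := hK.exists_norm_le_of_smul_mem_incrementSet hf hc hσ
  have hblowup := tendsto_measure_of_ae_tendsto_indicator (μ := μ.prod μ) (𝓝[>] (0 : ℝ))
    (A := {z | gauge K z.2 ^ (Module.finrank ℝ E / p + 1) ≤ |fderiv ℝ f z.1 z.2|})
    (As := fun τ : ℝ => (fun z : E × E => (z.1, τ • z.2)) ⁻¹'
      incrementSet K (Module.finrank ℝ E / p + 1) f (τ ^ (-(Module.finrank ℝ E / p : ℝ))))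
    (measurableSet_le (by fun_prop) (by fun_prop)) (fun τ => (hS _).preimage (by fun_prop))
    (measurableSet_closedBall.prod measurableSet_closedBall)
    ((isCompact_closedBall (0 : E) R).prod (isCompact_closedBall (0 : E) R)).measure_lt_top.ne
    (by
      filter_upwards [Ioc_mem_nhdsGT (zero_lt_one' ℝ)] with τ hτ z hz
      simpa using hR z.1 z.2 τ hτ.1 hτ.2 hz)
    (ae_eventually_smul_mem_incrementSet_iff μ hK hf hσ)
  have hτ : Tendsto (fun t : ℝ => t ^ (-(p / Module.finrank ℝ E))) atTop (𝓝[>] 0) :=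
    tendsto_nhdsWithin_iff.2 ⟨tendsto_rpow_neg_atTop (by positivity),
      (eventually_gt_atTop 0).mono fun t ht => Real.rpow_pos_of_pos ht _⟩
  rw [measure_gauge_rpow_le_abs_fderiv μ hK hf hp] at hblowup
  refine (hblowup.comp hτ).congr' ?_
  filter_upwards [eventually_gt_atTop 0] with t ht
  rw [Function.comp_apply, measure_preimage_prodMk_smul μ (hS _) (Real.rpow_pos_of_pos ht _),
    ← Real.rpow_mul_natCast ht.le, ← Real.rpow_mul ht.le, ← Real.rpow_neg ht.le]
  congr <;> field_simp
  rw [Real.rpow_one]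

end SmoothLimit

section SmallLevels

lemma tendsto_ofReal_rpow_mul_nhdsGT_zero {p : ℝ} (hp : 0 < p) {M : ℝ≥0∞} (hM : M ≠ ⊤) :
    Tendsto (fun t : ℝ => ENNReal.ofReal (t ^ p) * M) (𝓝[>] 0) (𝓝 0) := by
  have hpow : Tendsto (fun t : ℝ => t ^ p) (𝓝[>] 0) (𝓝 0) := by
    simpa [Real.zero_rpow hp.ne'] using
      ((Real.continuous_rpow_const hp.le).tendsto 0).mono_left nhdsWithin_le_nhds
  simpa using ENNReal.Tendsto.mul_const (ENNReal.tendsto_ofReal hpow) (Or.inr hM)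

lemma measure_le_abs_lt_top {α : Type*} [MeasurableSpace α] {ν : Measure α} {g : α → ℝ}
    (hg : Measurable g) {p : ℝ} (hp : 0 < p) (hgp : ∫⁻ a, ‖g a‖ₑ ^ p ∂ν ≠ ⊤) {δ : ℝ}
    (hδ : 0 < δ) : ν {a | δ ≤ |g a|} < ⊤ := by
  have hδp : ENNReal.ofReal δ ^ p ≠ 0 := by simp [hδ]
  calc ν {a | δ ≤ |g a|} ≤ ν {a | ENNReal.ofReal δ ^ p ≤ ‖g a‖ₑ ^ p} := by
        refine measure_mono fun a (ha : δ ≤ |g a|) => ?_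
        rw [Set.mem_ofPred_eq, Real.enorm_eq_ofReal_abs]
        gcongr
    _ ≤ (∫⁻ a, ‖g a‖ₑ ^ p ∂ν) / ENNReal.ofReal δ ^ p :=
        meas_ge_le_lintegral_div (by fun_prop) hδp (by finiteness)
    _ < ⊤ := ENNReal.div_lt_top hgp hδp

variable {E : Type*} [NormedAddCommGroup E] [NormedSpace ℝ E] {K : Set E} {f : E → ℝ}

/-- The pairs `(x, v)` for which the value of `f` at the base point `x` alone reaches the level
`t * ‖v‖_K ^ s`. -/
def baseSet (K : Set E) (s : ℝ) (f : E → ℝ) (t : ℝ) : Set (E × E) :=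
  {z | t * gauge K z.2 ^ s ≤ |f z.1|}

/-- The pairs `(x, v)` for which the value of `f` at the endpoint `x + v` alone reaches the level
`t * ‖v‖_K ^ s`. -/
def tipSet (K : Set E) (s : ℝ) (f : E → ℝ) (t : ℝ) : Set (E × E) :=
  {z | t * gauge K z.2 ^ s ≤ |f (z.1 + z.2)|}

lemma incrementSet_subset (K : Set E) (s : ℝ) (f : E → ℝ) (t ε : ℝ) :
    incrementSet K s f t ⊆ baseSet K s f ((1 - ε) * t) ∪ tipSet K s f ((1 - ε) * t) ∪
      baseSet K s f (ε * t) ∩ tipSet K s f (ε * t) := by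
  rintro ⟨x, v⟩ ⟨-, hz⟩
  simp only [baseSet, tipSet, Set.mem_union, Set.mem_inter_iff, Set.mem_ofPred_eq, mul_assoc]
  have habs := hz.trans (abs_sub (f (x + v)) (f x))
  dsimp only at habs
  by_contra! h
  obtain ⟨⟨hx, hy⟩, hov⟩ := h
  linarith [hov (by linarith)]

lemma baseSet_union_tipSet_subset (K : Set E) (s : ℝ) (f : E → ℝ) {t ε : ℝ} (ht : 0 ≤ t) :
    baseSet K s f ((1 + ε) * t) ∪ tipSet K s f ((1 + ε) * t) ⊆
      incrementSet K s f t ∪ baseSet K s f (ε * t) ∩ tipSet K s f (ε * t) ∪ {z | z.2 = 0} := by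
  rintro ⟨x, v⟩ hz
  have : 0 ≤ t * gauge K v ^ s := mul_nonneg ht (Real.rpow_nonneg (gauge_nonneg _) _)
  simp only [incrementSet, baseSet, tipSet, Set.mem_union, Set.mem_inter_iff, Set.mem_ofPred_eq,
    mul_assoc] at hz ⊢
  by_contra! h
  obtain ⟨⟨hinc, hov⟩, hv⟩ := h
  have hlt := hinc hv
  have hxy := abs_sub_abs_le_abs_sub (f (x + v)) (f x)
  have hyx := abs_sub_abs_le_abs_sub (f x) (f (x + v))
  rw [abs_sub_comm] at hyx
  rcases hz with hx | hy
  · linarith [hov (by linarith)]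
  · linarith [hov (by linarith)]

variable [MeasurableSpace E] [BorelSpace E]

lemma measurableSet_baseSet (hK : IsStarBody K) (hf : Measurable f) (s t : ℝ) :
    MeasurableSet (baseSet K s f t) := by
  have hN := hK.measurable_gauge
  exact measurableSet_le (by fun_prop) (by fun_prop)

variable [FiniteDimensional ℝ E]

lemma measurableSet_tipSet (hK : IsStarBody K) (hf : Measurable f) (s t : ℝ) :
    MeasurableSet (tipSet K s f t) := by
  have hN := hK.measurable_gauge
  exact measurableSet_le (by fun_prop) (by fun_prop)

variable (μ : Measure E) [μ.IsAddHaarMeasure]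

lemma measure_tipSet (hK : IsStarBody K) (hf : Measurable f) (s t : ℝ) :
    μ.prod μ (tipSet K s f t) = μ.prod μ (baseSet K s f t) := by
  rw [Measure.prod_apply_symm (measurableSet_tipSet hK hf s t),
    Measure.prod_apply_symm (measurableSet_baseSet hK hf s t)]
  exact lintegral_congr fun v => measure_preimage_add_right μ v {x | (x, v) ∈ baseSet K s f t}

variable [Nontrivial E]

lemma IsStarBody.ofReal_rpow_mul_measure_gauge_rpow_le (hK : IsStarBody K) {p t : ℝ}
    (hp : 0 < p) (ht : 0 < t) (c : ℝ) :
    ENNReal.ofReal (t ^ p) * μ {v | t * gauge K v ^ (Module.finrank ℝ E / p : ℝ) ≤ |c|} =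
      ‖c‖ₑ ^ p * μ K := by
  have hd : (0 : ℝ) < Module.finrank ℝ E := Nat.cast_pos.2 Module.finrank_pos
  have hiff : ∀ v, t * gauge K v ^ (Module.finrank ℝ E / p : ℝ) ≤ |c| ↔
      gauge K v ≤ (|c| / t) ^ (p / Module.finrank ℝ E) := fun v => by
    rw [← Real.rpow_inv_le_iff_of_pos (gauge_nonneg _) (by positivity) (by positivity), inv_div,
      le_div_iff₀' ht]
  simp only [hiff]
  rcases eq_or_ne c 0 with rfl | hc
  · have hzero : {v | gauge K v ≤ (|0| / t) ^ (p / Module.finrank ℝ E)} = {0} := by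
      ext v
      simpa [Real.zero_rpow (div_pos hp hd).ne'] using (hK.gauge_pos (v := v)).not
    rw [hzero]
    simp [hp]
  · rw [hK.measure_gauge_le μ (by positivity), ← mul_assoc, ← ENNReal.ofReal_mul (by positivity),
      ← Real.rpow_mul_natCast (by positivity), div_mul_cancel₀ _ hd.ne',
      ← Real.mul_rpow ht.le (by positivity), mul_div_cancel₀ _ ht.ne',
      ← ENNReal.ofReal_rpow_of_nonneg (abs_nonneg c) hp.le, Real.enorm_eq_ofReal_abs]

lemma ofReal_rpow_mul_measure_baseSet (hK : IsStarBody K) (hf : Measurable f) {p t : ℝ}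
    (hp : 0 < p) (ht : 0 < t) :
    ENNReal.ofReal (t ^ p) * μ.prod μ (baseSet K (Module.finrank ℝ E / p) f t) =
      (∫⁻ x, ‖f x‖ₑ ^ p ∂μ) * μ K := by
  rw [Measure.prod_apply (measurableSet_baseSet hK hf _ t),
    ← lintegral_const_mul' _ _ ENNReal.ofReal_ne_top,
    ← lintegral_mul_const' _ _ hK.isCompact.measure_ne_top]
  exact lintegral_congr fun x => hK.ofReal_rpow_mul_measure_gauge_rpow_le μ hp ht (f x)

lemma ofReal_rpow_mul_measure_baseSet_add_tipSet (hK : IsStarBody K) (hf : Measurable f) {p c t : ℝ}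
    (hp : 0 < p) (hc : 0 < c) (ht : 0 < t) :
    ENNReal.ofReal (t ^ p) * (μ.prod μ (baseSet K (Module.finrank ℝ E / p) f (c * t)) +
        μ.prod μ (tipSet K (Module.finrank ℝ E / p) f (c * t))) =
      ENNReal.ofReal (c⁻¹ ^ p) * (2 * μ K * ∫⁻ x, ‖f x‖ₑ ^ p ∂μ) := by
  have ht' : t ^ p = c⁻¹ ^ p * (c * t) ^ p := by
    rw [← Real.mul_rpow (by positivity) (by positivity), inv_mul_cancel_left₀ hc.ne']
  rw [measure_tipSet μ hK hf, ht', ENNReal.ofReal_mul (by positivity), ← two_mul, mul_assoc,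
    mul_left_comm (ENNReal.ofReal ((c * t) ^ p)),
    ofReal_rpow_mul_measure_baseSet μ hK hf hp (mul_pos hc ht)]
  ring

theorem ofReal_rpow_mul_measure_incrementSet_le_lintegral (hK : IsStarBody K) (hf : Measurable f)
    {p t : ℝ} (hp : 0 < p) (ht : 0 < t) :
    ENNReal.ofReal (t ^ p) * μ.prod μ (incrementSet K (Module.finrank ℝ E / p) f t) ≤
      ENNReal.ofReal (2 ^ p) * (2 * μ K * ∫⁻ x, ‖f x‖ₑ ^ p ∂μ) := by
  have hsub := incrementSet_subset K (Module.finrank ℝ E / p) f t 2⁻¹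
  rw [show (1 - 2⁻¹ : ℝ) = 2⁻¹ by norm_num, Set.union_eq_self_of_subset_right
    (Set.inter_subset_left.trans Set.subset_union_left)] at hsub
  rw [← inv_inv (2 : ℝ), ← ofReal_rpow_mul_measure_baseSet_add_tipSet μ hK hf hp (by simp) ht]
  gcongr
  exact (measure_mono hsub).trans (measure_union_le _ _)

lemma IsStarBody.tendsto_rpow_mul_measure_gauge_rpow_le_abs (hK : IsStarBody K)
    (hf : Measurable f) {p : ℝ} (hp : 0 < p) (hfp : ∫⁻ x, ‖f x‖ₑ ^ p ∂μ ≠ ⊤) :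
    Tendsto (fun t : ℝ => ENNReal.ofReal (t ^ p) *
      μ {v | t * gauge K v ^ (Module.finrank ℝ E / p : ℝ) ≤ |f v|}) (𝓝[>] 0) (𝓝 0) := by
  rw [ENNReal.tendsto_nhds_zero]
  intro ε hε
  have hhalf : 0 < ε / 2 := ENNReal.half_pos hε.ne'
  obtain ⟨δ, hδε, hδ⟩ := ((ENNReal.tendsto_nhds_zero.1 (tendsto_ofReal_rpow_mul_nhdsGT_zero hp
    (hK.isCompact.measure_ne_top (μ := μ))) _ hhalf).and self_mem_nhdsWithin).exists
  replace hδ : 0 < δ := hδ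
  filter_upwards [ENNReal.tendsto_nhds_zero.1 (tendsto_ofReal_rpow_mul_nhdsGT_zero hp
    (measure_le_abs_lt_top hf hp hfp hδ).ne) _ hhalf, self_mem_nhdsWithin] with t htε ht
  have hsplit : {v | t * gauge K v ^ (Module.finrank ℝ E / p : ℝ) ≤ |f v|} ⊆
      {v | t * gauge K v ^ (Module.finrank ℝ E / p : ℝ) ≤ |δ|} ∪ {v | δ ≤ |f v|} := fun v hv =>
    (le_total |f v| δ).imp (fun h => (hv.trans h).trans (le_abs_self δ)) id
  calc _ ≤ ENNReal.ofReal (t ^ p) * (μ {v | t * gauge K v ^ (Module.finrank ℝ E / p : ℝ) ≤ |δ|} +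
          μ {v | δ ≤ |f v|}) := by
        gcongr
        exact (measure_mono hsplit).trans (measure_union_le _ _)
    _ = ENNReal.ofReal (δ ^ p) * μ K + ENNReal.ofReal (t ^ p) * μ {v | δ ≤ |f v|} := by
        rw [mul_add, hK.ofReal_rpow_mul_measure_gauge_rpow_le μ hp ht, Real.enorm_of_nonneg hδ.le,
          ENNReal.ofReal_rpow_of_nonneg hδ.le hp.le]
    _ ≤ ε := (add_le_add hδε htε).trans_eq (ENNReal.add_halves ε)

lemma tendsto_rpow_mul_measure_baseSet_inter_tipSet (hK : IsStarBody K) (hf : Measurable f)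
    {p : ℝ} (hp : 0 < p) (hfp : ∫⁻ x, ‖f x‖ₑ ^ p ∂μ ≠ ⊤) :
    Tendsto (fun t : ℝ => ENNReal.ofReal (t ^ p) *
      μ.prod μ (baseSet K (Module.finrank ℝ E / p) f t ∩ tipSet K (Module.finrank ℝ E / p) f t))
      (𝓝[>] 0) (𝓝 0) := by
  have hmeas := fun t => (measurableSet_baseSet hK hf (Module.finrank ℝ E / p) t).inter
    (measurableSet_tipSet hK hf (Module.finrank ℝ E / p) t)
  simp only [Measure.prod_apply (hmeas _), ← lintegral_const_mul' _ _ ENNReal.ofReal_ne_top]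
  rw [← lintegral_zero (μ := μ)]
  refine tendsto_lintegral_filter_of_dominated_convergence (fun x => ‖f x‖ₑ ^ p * μ K)
    (Eventually.of_forall fun t => (measurable_measure_prodMk_left (hmeas t)).const_mul _)
    ?_ ?_ (ae_of_all _ fun x => ?_)
  · filter_upwards [self_mem_nhdsWithin] with t ht
    refine ae_of_all _ fun x => ?_
    rw [← hK.ofReal_rpow_mul_measure_gauge_rpow_le μ hp ht]
    gcongr
    exact fun v hv => hv.1
  · rw [lintegral_mul_const' _ _ hK.isCompact.measure_ne_top]
    exact ENNReal.mul_ne_top hfp hK.isCompact.measure_ne_top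
  · have htranslate : ∫⁻ v, ‖f (x + v)‖ₑ ^ p ∂μ ≠ ⊤ := by
      rwa [lintegral_add_left_eq_self (fun y => ‖f y‖ₑ ^ p) x]
    refine tendsto_of_tendsto_of_tendsto_of_le_of_le tendsto_const_nhds
      (hK.tendsto_rpow_mul_measure_gauge_rpow_le_abs μ (f := fun v => f (x + v)) (by fun_prop) hp
        htranslate) (fun _ => zero_le) fun t => ?_
    dsimp only
    gcongr
    exact fun v hv => hv.2

lemma measure_setOf_snd_eq_zero : μ.prod μ {z : E × E | z.2 = 0} = 0 :=
  Measure.measure_prod_null_of_ae_null (measurableSet_eq_fun measurable_snd measurable_const)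
    (ae_of_all _ fun _ => measure_singleton (0 : E))

lemma measure_baseSet_add_tipSet_le (hK : IsStarBody K) (hf : Measurable f) {s t ε : ℝ}
    (ht : 0 ≤ t) :
    μ.prod μ (baseSet K s f ((1 + ε) * t)) + μ.prod μ (tipSet K s f ((1 + ε) * t)) ≤
      μ.prod μ (incrementSet K s f t) + (μ.prod μ (baseSet K s f (ε * t) ∩ tipSet K s f (ε * t)) +
        μ.prod μ (baseSet K s f ((1 + ε) * t) ∩ tipSet K s f ((1 + ε) * t))) := by
  rw [← measure_union_add_inter _ (measurableSet_tipSet hK hf s _), ← add_assoc]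
  gcongr
  calc _ ≤ μ.prod μ (incrementSet K s f t ∪ baseSet K s f (ε * t) ∩ tipSet K s f (ε * t) ∪
          {z | z.2 = 0}) := measure_mono (baseSet_union_tipSet_subset K s f ht)
    _ ≤ _ := (measure_union_le _ _).trans_eq (by rw [measure_setOf_snd_eq_zero, add_zero])
    _ ≤ _ := measure_union_le _ _

lemma tendsto_rpow_mul_measure_overlap_mul (hK : IsStarBody K) (hf : Measurable f) {p c : ℝ}
    (hp : 0 < p) (hc : 0 < c) (hfp : ∫⁻ x, ‖f x‖ₑ ^ p ∂μ ≠ ⊤) :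
    Tendsto (fun t : ℝ => ENNReal.ofReal (t ^ p) *
      μ.prod μ (baseSet K (Module.finrank ℝ E / p) f (c * t) ∩
        tipSet K (Module.finrank ℝ E / p) f (c * t))) (𝓝[>] 0) (𝓝 0) := by
  have hscale : Tendsto (fun t : ℝ => c * t) (𝓝[>] 0) (𝓝[>] 0) := by
    refine tendsto_nhdsWithin_iff.2 ⟨?_, eventually_mem_nhdsWithin.mono fun t ht => mul_pos hc ht⟩
    simpa using ((continuous_const_mul c).tendsto 0).mono_left nhdsWithin_le_nhds
  have hlim := ENNReal.Tendsto.const_mul (a := ENNReal.ofReal (c⁻¹ ^ p))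
    ((tendsto_rpow_mul_measure_baseSet_inter_tipSet μ hK hf hp hfp).comp hscale)
    (Or.inr ENNReal.ofReal_ne_top)
  rw [mul_zero] at hlim
  refine hlim.congr' ?_
  filter_upwards [self_mem_nhdsWithin] with t ht
  replace ht : 0 < t := ht
  rw [Function.comp_apply, ← mul_assoc, ← ENNReal.ofReal_mul (by positivity),
    ← Real.mul_rpow (by positivity) (by positivity), inv_mul_cancel_left₀ hc.ne']

lemma limsup_rpow_mul_measure_incrementSet_le (hK : IsStarBody K) (hf : Measurable f) {p ε : ℝ}
    (hp : 0 < p) (hfp : ∫⁻ x, ‖f x‖ₑ ^ p ∂μ ≠ ⊤) (hε : 0 < ε) (hε1 : ε < 1) :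
    limsup (fun t : ℝ => ENNReal.ofReal (t ^ p) *
        μ.prod μ (incrementSet K (Module.finrank ℝ E / p) f t)) (𝓝[>] 0) ≤
      ENNReal.ofReal ((1 - ε)⁻¹ ^ p) * (2 * μ K * ∫⁻ x, ‖f x‖ₑ ^ p ∂μ) := by
  have hlim := (tendsto_rpow_mul_measure_overlap_mul μ hK hf hp hε hfp).const_add
    (ENNReal.ofReal ((1 - ε)⁻¹ ^ p) * (2 * μ K * ∫⁻ x, ‖f x‖ₑ ^ p ∂μ))
  rw [add_zero] at hlim
  refine le_of_le_of_eq (limsup_le_limsup ?_) hlim.limsup_eq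
  filter_upwards [self_mem_nhdsWithin] with t ht
  rw [← ofReal_rpow_mul_measure_baseSet_add_tipSet μ hK hf hp (sub_pos.2 hε1) ht, ← mul_add]
  gcongr
  exact (measure_mono (incrementSet_subset K _ f t ε)).trans <|
    (measure_union_le _ _).trans (add_le_add_left (measure_union_le _ _) _)

lemma le_liminf_rpow_mul_measure_incrementSet (hK : IsStarBody K) (hf : Measurable f) {p ε : ℝ}
    (hp : 0 < p) (hfp : ∫⁻ x, ‖f x‖ₑ ^ p ∂μ ≠ ⊤) (hε : 0 < ε) :
    ENNReal.ofReal ((1 + ε)⁻¹ ^ p) * (2 * μ K * ∫⁻ x, ‖f x‖ₑ ^ p ∂μ) ≤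
      liminf (fun t : ℝ => ENNReal.ofReal (t ^ p) *
        μ.prod μ (incrementSet K (Module.finrank ℝ E / p) f t)) (𝓝[>] 0) := by
  have hfin : ENNReal.ofReal ((1 + ε)⁻¹ ^ p) * (2 * μ K * ∫⁻ x, ‖f x‖ₑ ^ p ∂μ) ≠ ⊤ := by
    have := hK.isCompact.measure_ne_top (μ := μ)
    finiteness
  have hlim := ENNReal.Tendsto.sub
    (tendsto_const_nhds (x := ENNReal.ofReal ((1 + ε)⁻¹ ^ p) * (2 * μ K * ∫⁻ x, ‖f x‖ₑ ^ p ∂μ)))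
    ((tendsto_rpow_mul_measure_overlap_mul μ hK hf hp hε hfp).add
      (tendsto_rpow_mul_measure_overlap_mul μ hK hf hp (by positivity : 0 < 1 + ε) hfp))
    (Or.inl hfin)
  rw [add_zero, tsub_zero] at hlim
  refine le_of_eq_of_le hlim.liminf_eq.symm (liminf_le_liminf ?_)
  filter_upwards [self_mem_nhdsWithin] with t ht
  rw [← ofReal_rpow_mul_measure_baseSet_add_tipSet μ hK hf hp (by positivity : 0 < 1 + ε) ht,
    tsub_le_iff_right, ← mul_add, ← mul_add]
  exact mul_le_mul_right (measure_baseSet_add_tipSet_le μ hK hf (le_of_lt ht)) _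

lemma tendsto_ofReal_inv_rpow_mul (p : ℝ) (c : ℝ≥0∞) :
    Tendsto (fun a : ℝ => ENNReal.ofReal (a⁻¹ ^ p) * c) (𝓝 1) (𝓝 c) := by
  have hpow : Tendsto (fun a : ℝ => a⁻¹ ^ p) (𝓝 1) (𝓝 1) := by
    have hcont : ContinuousAt (fun a : ℝ => a⁻¹ ^ p) 1 := by fun_prop (disch := simp)
    simpa [ContinuousAt] using hcont
  simpa using ENNReal.Tendsto.mul_const (ENNReal.tendsto_ofReal hpow) (Or.inl (by simp))

theorem tendsto_rpow_mul_measure_incrementSet_nhdsGT_zero (hK : IsStarBody K) (hf : Measurable f)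
    {p : ℝ} (hp : 0 < p) (hfp : ∫⁻ x, ‖f x‖ₑ ^ p ∂μ ≠ ⊤) :
    Tendsto (fun t : ℝ => ENNReal.ofReal (t ^ p) *
      μ.prod μ (incrementSet K (Module.finrank ℝ E / p) f t)) (𝓝[>] 0)
      (𝓝 (2 * μ K * ∫⁻ x, ‖f x‖ₑ ^ p ∂μ)) := by
  have hadd : Tendsto (fun ε : ℝ => 1 + ε) (𝓝[>] 0) (𝓝 1) := by
    simpa using ((continuous_const_add (1 : ℝ)).tendsto 0).mono_left nhdsWithin_le_nhds
  have hsub : Tendsto (fun ε : ℝ => 1 - ε) (𝓝[>] 0) (𝓝 1) := by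
    simpa using ((continuous_sub_left (1 : ℝ)).tendsto 0).mono_left nhdsWithin_le_nhds
  refine tendsto_of_le_liminf_of_limsup_le
    (le_of_tendsto ((tendsto_ofReal_inv_rpow_mul p _).comp hadd) ?_)
    (ge_of_tendsto ((tendsto_ofReal_inv_rpow_mul p _).comp hsub) ?_)
  · filter_upwards [self_mem_nhdsWithin] with ε hε
    exact le_liminf_rpow_mul_measure_incrementSet μ hK hf hp hfp hε
  · filter_upwards [Ioo_mem_nhdsGT (zero_lt_one' ℝ)] with ε hε
    exact limsup_rpow_mul_measure_incrementSet_le μ hK hf hp hfp hε.1 hε.2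

end SmallLevels

section EuclideanSpace

variable {n : ℕ} {K : Set (Rn n)} {f : Rn n → ℝ}

lemma IsSymmConvexBody.isStarBody (hK : IsSymmConvexBody K) : IsStarBody K := by
  obtain ⟨x, hx⟩ := hK.nonempty_interior
  have hmid := hK.convex.combo_interior_self_mem_interior hx (hK.neg_mem x (interior_subset hx))
    (a := 1 / 2) (b := 1 / 2) (by norm_num) (by norm_num) (by norm_num)
  rw [smul_neg, add_neg_cancel] at hmid
  exact ⟨hK.isCompact, hK.convex.starConvex (interior_subset hmid),
    absorbent_nhds_zero (mem_interior_iff_mem_nhds.1 hmid)⟩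

lemma preimage_superlevelSet (hK : IsStarBody K) (s : ℝ) (f : Rn n → ℝ) (t : ℝ) :
    (fun z : Rn n × Rn n => (z.1 + z.2, z.1)) ⁻¹' superlevelSet K s f t = incrementSet K s f t := by
  ext ⟨x, v⟩
  simp only [superlevelSet, incrementSet, Set.mem_preimage, Set.mem_ofPred_eq,
    add_sub_cancel_left, ne_eq, add_eq_left]
  refine and_congr_right fun hv => le_div_iff₀ ?_
  exact Real.rpow_pos_of_pos (hK.gauge_pos.2 hv) _

lemma volume_superlevelSet (hK : IsStarBody K) (s : ℝ) (f : Rn n → ℝ) (t : ℝ) :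
    volume (superlevelSet K s f t) =
      ((volume : Measure (Rn n)).prod volume) (incrementSet K s f t) := by
  have hshear : MeasurePreserving
      ((MeasurableEquiv.shearAddRight (Rn n)).trans MeasurableEquiv.prodComm)
      (volume.prod volume) (volume.prod volume) :=
    Measure.measurePreserving_swap.comp (measurePreserving_prod_add volume volume)
  rw [← preimage_superlevelSet hK]
  exact (hshear.measure_preimage_equiv _).symm

lemma volume_superlevelSet_congr {g : Rn n → ℝ} (hfg : f =ᵐ[volume] g) (s t : ℝ) :
    volume (superlevelSet K s f t) = volume (superlevelSet K s g t) := by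
  refine measure_congr ?_
  rw [Measure.volume_eq_prod]
  filter_upwards [Measure.quasiMeasurePreserving_fst.ae hfg,
    Measure.quasiMeasurePreserving_snd.ae hfg] with z h₁ h₂
  change (z ∈ superlevelSet K s f t) = (z ∈ superlevelSet K s g t)
  simp only [superlevelSet, Set.mem_ofPred_eq, h₁, h₂]

lemma setOf_le_abs_anisotropicQuotient (K : Set (Rn n)) (s : ℝ) (f : Rn n → ℝ) {t : ℝ}
    (ht : 0 < t) : {z | t ≤ |anisotropicQuotient K s f z|} = superlevelSet K s f t := by
  ext z
  have habs : |anisotropicQuotient K s f z| = |f z.1 - f z.2| / gauge K (z.1 - z.2) ^ s := by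
    rw [anisotropicQuotient, abs_div, abs_of_nonneg (Real.rpow_nonneg (gauge_nonneg _) _)]
  rw [Set.mem_ofPred_eq, habs]
  refine ⟨fun hz => ⟨fun hdiag => ?_, hz⟩, And.right⟩
  rw [hdiag, sub_self, abs_zero, zero_div] at hz
  exact ht.not_ge hz

lemma weakLpQuasinormPow_anisotropicQuotient (K : Set (Rn n)) (p s : ℝ) (f : Rn n → ℝ) :
    weakLpQuasinormPow p (anisotropicQuotient K s f) =
      ⨆ (t : ℝ) (_ : 0 < t), ENNReal.ofReal (t ^ p) * volume (superlevelSet K s f t) :=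
  iSup_congr fun _ => iSup_congr fun ht => by rw [setOf_le_abs_anisotropicQuotient K s f ht]

lemma le_weakLpQuasinormPow_of_tendsto {p s : ℝ} {l : Filter ℝ} [l.NeBot] (hl : ∀ᶠ t in l, 0 < t)
    {a : ℝ≥0∞} (h : Tendsto (fun t : ℝ =>
      ENNReal.ofReal (t ^ p) * volume (superlevelSet K s f t)) l (𝓝 a)) :
    a ≤ weakLpQuasinormPow p (anisotropicQuotient K s f) := by
  rw [weakLpQuasinormPow_anisotropicQuotient]
  refine le_of_tendsto h (hl.mono fun t ht => ?_)
  exact le_iSup₂ (f := fun (t : ℝ) (_ : 0 < t) =>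
    ENNReal.ofReal (t ^ p) * volume (superlevelSet K s f t)) t ht

lemma anisotropicEnergy_eq_lintegral_fderiv (K : Set (Rn n)) {p : ℝ} (hp : 0 ≤ p)
    (f : Rn n → ℝ) :
    anisotropicEnergy K p f =
      ENNReal.ofReal ((n + p) / 2) * ∫⁻ x, ∫⁻ v in K, ‖fderiv ℝ f x v‖ₑ ^ p := by
  have hinner : ∀ x v : Rn n,
      ENNReal.ofReal (|inner ℝ (∇ f x) v| ^ p) = ‖fderiv ℝ f x v‖ₑ ^ p := fun x v => by
    rw [gradient, InnerProductSpace.toDual_symm_apply, Real.enorm_eq_ofReal_abs,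
      ENNReal.ofReal_rpow_of_nonneg (abs_nonneg _) hp]
  simp only [anisotropicEnergy, polarMomentNormPow, hinner,
    lintegral_const_mul' _ _ ENNReal.ofReal_ne_top]

lemma eLpNorm_ofReal_rpow {α : Type*} [MeasurableSpace α] {ν : Measure α} {g : α → ℝ} {p : ℝ}
    (hp : 0 < p) : eLpNorm g (ENNReal.ofReal p) ν ^ p = ∫⁻ a, ‖g a‖ₑ ^ p ∂ν := by
  rw [eLpNorm_eq_lintegral_rpow_enorm_toReal (by simpa using hp) ENNReal.ofReal_ne_top,
    ENNReal.toReal_ofReal hp.le, ← ENNReal.rpow_mul, one_div_mul_cancel hp.ne', ENNReal.rpow_one]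

variable [NeZero n]

lemma two_div_mul_anisotropicEnergy (K : Set (Rn n)) {p : ℝ} (hp : 0 ≤ p) (f : Rn n → ℝ) :
    2 / (n : ℝ≥0∞) * anisotropicEnergy K p f =
      ENNReal.ofReal ((n + p) / n) * ∫⁻ x, ∫⁻ v in K, ‖fderiv ℝ f x v‖ₑ ^ p := by
  have hn : (0 : ℝ) < n := Nat.cast_pos.2 (NeZero.pos n)
  have htwo : 2 / (n : ℝ≥0∞) = ENNReal.ofReal (2 / n) := by
    rw [ENNReal.ofReal_div_of_pos hn, ENNReal.ofReal_natCast, ENNReal.ofReal_ofNat]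
  rw [anisotropicEnergy_eq_lintegral_fderiv K hp, htwo, ← mul_assoc,
    ← ENNReal.ofReal_mul (by positivity)]
  congr 2
  field_simp

theorem tendsto_rpow_mul_volume_superlevelSet_atTop (hK : IsStarBody K) (hf : ContDiff ℝ 1 f)
    (hc : HasCompactSupport f) {p : ℝ} (hp : 0 < p) :
    Tendsto (fun t : ℝ => ENNReal.ofReal (t ^ p) * volume (superlevelSet K (n / p + 1) f t))
      atTop (𝓝 (2 / (n : ℝ≥0∞) * anisotropicEnergy K p f)) := by
  simp only [two_div_mul_anisotropicEnergy K hp.le, volume_superlevelSet hK]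
  simpa only [finrank_euclideanSpace_fin] using
    tendsto_rpow_mul_measure_incrementSet_atTop volume hK hf hc hp

theorem weakLpQuasinormPow_le_anisotropicEnergy (hK : IsStarBody K) (hf : ContDiff ℝ 1 f) {p : ℝ}
    (hp : 1 ≤ p) :
    weakLpQuasinormPow p (anisotropicQuotient K (n / p + 1) f) ≤
      ENNReal.ofReal (4 * 5 ^ (n + 1) / n) * anisotropicEnergy K p f := by
  have hn : (0 : ℝ) < n := Nat.cast_pos.2 (NeZero.pos n)
  have hconst : ENNReal.ofReal (4 * 5 ^ (n + 1) / n) * ENNReal.ofReal ((n + p) / 2) =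
      2 * ENNReal.ofReal (5 ^ (n + 1 : ℝ) / n) * ENNReal.ofReal (n + p) := by
    rw [← ENNReal.ofReal_ofNat 2, ← ENNReal.ofReal_mul (by positivity),
      ← ENNReal.ofReal_mul (by positivity), ← ENNReal.ofReal_mul (by positivity),
      ← Nat.cast_add_one, Real.rpow_natCast]
    congr 1
    ring
  rw [weakLpQuasinormPow_anisotropicQuotient]
  refine iSup₂_le fun t ht => ?_
  rw [volume_superlevelSet hK, anisotropicEnergy_eq_lintegral_fderiv K (by linarith), ← mul_assoc,
    hconst, mul_assoc (2 * _)]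
  simpa only [finrank_euclideanSpace_fin] using
    ofReal_rpow_mul_measure_incrementSet_le volume hK hp ht hf

theorem tendsto_rpow_mul_volume_superlevelSet_nhdsGT_zero (hK : IsStarBody K) {p : ℝ} (hp : 0 < p)
    (hf : MemLp f (ENNReal.ofReal p) volume) :
    Tendsto (fun t : ℝ => ENNReal.ofReal (t ^ p) * volume (superlevelSet K (n / p) f t))
      (𝓝[>] 0) (𝓝 (2 * volume K * eLpNorm f (ENNReal.ofReal p) volume ^ p)) := by
  obtain ⟨g, hg, hfg⟩ := hf.aestronglyMeasurable
  have hgp : ∫⁻ x, ‖g x‖ₑ ^ p ≠ ⊤ := by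
    rw [← eLpNorm_ofReal_rpow hp, ← eLpNorm_congr_ae hfg]
    exact ENNReal.rpow_ne_top_of_nonneg hp.le hf.eLpNorm_ne_top
  simp only [volume_superlevelSet_congr hfg, eLpNorm_congr_ae hfg, eLpNorm_ofReal_rpow hp,
    volume_superlevelSet hK]
  simpa only [finrank_euclideanSpace_fin] using
    tendsto_rpow_mul_measure_incrementSet_nhdsGT_zero volume hK hg.measurable hp hgp

theorem weakLpQuasinormPow_le_eLpNorm (hK : IsStarBody K) {p : ℝ} (hp : 0 < p)
    (hf : AEStronglyMeasurable f volume) :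
    weakLpQuasinormPow p (anisotropicQuotient K (n / p) f) ≤
      ENNReal.ofReal (2 ^ (p + 1)) * volume K * eLpNorm f (ENNReal.ofReal p) volume ^ p := by
  obtain ⟨g, hg, hfg⟩ := hf
  have hconst : ENNReal.ofReal (2 ^ (p + 1)) = ENNReal.ofReal (2 ^ p) * 2 := by
    rw [Real.rpow_add_one two_ne_zero, ENNReal.ofReal_mul (by positivity), ENNReal.ofReal_ofNat]
  rw [weakLpQuasinormPow_anisotropicQuotient]
  refine iSup₂_le fun t ht => ?_
  rw [volume_superlevelSet_congr hfg, eLpNorm_congr_ae hfg, eLpNorm_ofReal_rpow hp,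
    volume_superlevelSet hK, hconst, mul_assoc (ENNReal.ofReal (2 ^ p)), mul_assoc]
  simpa only [finrank_euclideanSpace_fin] using
    ofReal_rpow_mul_measure_incrementSet_le_lintegral volume hK hg.measurable hp ht

end EuclideanSpace

theorem theorem1_general (n : ℕ) (hn : 1 ≤ n) :
    (∃ C : ℝ≥0, 0 < C ∧ ∀ (p : ℝ), 0 < p → ∀ (K : Set (Rn n)), IsStarBody K →
      ∀ f : Rn n → ℝ, ContDiff ℝ 1 f → HasCompactSupport f →
        (2 / (n : ℝ≥0∞)) * anisotropicEnergy K p f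
            ≤ weakLpQuasinormPow p (anisotropicQuotient K (n / p + 1) f) ∧
        (1 ≤ p → weakLpQuasinormPow p (anisotropicQuotient K (n / p + 1) f)
            ≤ (C : ℝ≥0∞) * anisotropicEnergy K p f) ∧
        Tendsto (fun t : ℝ =>
            ENNReal.ofReal (t ^ p) * volume (superlevelSet K (n / p + 1) f t))
          atTop (𝓝 ((2 / (n : ℝ≥0∞)) * anisotropicEnergy K p f))) ∧
    (∀ (p : ℝ), 0 < p → ∀ (K : Set (Rn n)), IsStarBody K →
      ∀ f : Rn n → ℝ, MemLp f (ENNReal.ofReal p) volume →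
        2 * volume K * eLpNorm f (ENNReal.ofReal p) volume ^ p
            ≤ weakLpQuasinormPow p (anisotropicQuotient K (n / p) f) ∧
        weakLpQuasinormPow p (anisotropicQuotient K (n / p) f)
            ≤ ENNReal.ofReal (2 ^ (p + 1)) * volume K *
              eLpNorm f (ENNReal.ofReal p) volume ^ p ∧
        Tendsto (fun t : ℝ =>
            ENNReal.ofReal (t ^ p) * volume (superlevelSet K (n / p) f t))
          (𝓝[>] 0) (𝓝 (2 * volume K * eLpNorm f (ENNReal.ofReal p) volume ^ p))) := by
  have : NeZero n := ⟨by omega⟩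
  refine ⟨⟨(4 * 5 ^ (n + 1) / n : ℝ).toNNReal, by positivity, fun p hp K hK f hf hc => ?_⟩,
    fun p hp K hK f hf => ?_⟩
  · have hlim := tendsto_rpow_mul_volume_superlevelSet_atTop hK hf hc hp
    exact ⟨le_weakLpQuasinormPow_of_tendsto (eventually_gt_atTop 0) hlim,
      weakLpQuasinormPow_le_anisotropicEnergy hK hf, hlim⟩
  · have hlim := tendsto_rpow_mul_volume_superlevelSet_nhdsGT_zero hK hp hf
    exact ⟨le_weakLpQuasinormPow_of_tendsto (l := 𝓝[>] 0) self_mem_nhdsWithin hlim,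
      weakLpQuasinormPow_le_eLpNorm hK hp hf.1, hlim⟩

theorem theorem1 (n : ℕ) (hn : 1 ≤ n) :
    (∃ C : ℝ≥0, 0 < C ∧ ∀ (p : ℝ), 1 ≤ p → ∀ (K : Set (Rn n)), IsSymmConvexBody K →
      ∀ f : Rn n → ℝ, ContDiff ℝ ∞ f → HasCompactSupport f →
        (2 / (n : ℝ≥0∞)) * anisotropicEnergy K p f
            ≤ weakLpQuasinormPow p (anisotropicQuotient K (n / p + 1) f) ∧
        weakLpQuasinormPow p (anisotropicQuotient K (n / p + 1) f)
            ≤ (C : ℝ≥0∞) * anisotropicEnergy K p f ∧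
        Tendsto (fun t : ℝ =>
            ENNReal.ofReal (t ^ p) * volume (superlevelSet K (n / p + 1) f t))
          atTop (𝓝 ((2 / (n : ℝ≥0∞)) * anisotropicEnergy K p f))) ∧
    (∀ (p : ℝ), 1 ≤ p → ∀ (K : Set (Rn n)), IsSymmConvexBody K →
      ∀ f : Rn n → ℝ, MemLp f (ENNReal.ofReal p) volume →
        2 * volume K * eLpNorm f (ENNReal.ofReal p) volume ^ p
            ≤ weakLpQuasinormPow p (anisotropicQuotient K (n / p) f) ∧
        weakLpQuasinormPow p (anisotropicQuotient K (n / p) f)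
            ≤ ENNReal.ofReal (2 ^ (p + 1)) * volume K *
              eLpNorm f (ENNReal.ofReal p) volume ^ p ∧
        Tendsto (fun t : ℝ =>
            ENNReal.ofReal (t ^ p) * volume (superlevelSet K (n / p) f t))
          (𝓝[>] 0) (𝓝 (2 * volume K * eLpNorm f (ENNReal.ofReal p) volume ^ p))) := by
  obtain ⟨⟨C, hC, hsmooth⟩, hLp⟩ := theorem1_general n hn
  exact ⟨⟨C, hC, fun p hp K hK f hf hc =>
      (hsmooth p (by linarith) K hK.isStarBody f (hf.of_le (by simp)) hc).imp_right
        (And.imp_left (· hp))⟩,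
    fun p hp K hK => hLp p (by linarith) K hK.isStarBody⟩
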